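/- Let $K$ be a field and let $E$ be a finite directed graph (finitely many vertices and edges, source and range maps $s,r:E^1\to E^0$) with no sinks (every vertex emits an edge) and at least two vertices. Let $v\in E^0$ be a source (a vertex that receives no edges), and let $E_{\backslash v}$ be the graph obtained from $E$ by removing $v$ and all edges emitted by $v$. For a finite graph $F$, the Leavitt path algebra $\mathcal L(F)=\mathcal L_K(F)$ is the $K$-algebra generated by the vertices $u\in F^0$, the edges $\alpha\in F^1$ and the ghost edges $\alpha^*$ $(\alpha\in F^1)$ subject to the relations $uu'=\delta_{u,u'}u$; $s(\alpha)\alpha=\alpha r(\alpha)=\alpha$ and $r(\alpha)\alpha^*=\alpha^*s(\alpha)=\alpha^*$; $\alpha^*\beta=\delta_{\alpha,\beta}r(\alpha)$; and $\sum_{s(\alpha)=u}\alpha\alpha^*=u$ for every vertex $u$ that emits an edge. It has the identity $\sum_{u\in F^0}u$ and is $\mathbb Z$-graded by $\deg u=0$, $\deg\alpha=1$, $\deg\alpha^*=-1$. For a $\mathbb Z$-graded ring $A$ let $\operatorname{Gr-}A$ be the category of $\mathbb Z$-graded right $A$-modules and degree-preserving homomorphisms, with the shift functors $\mathcal T_k:M\mapsto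 M(k)$, $M(k)_i=M_{i+k}$. Graded rings $A$ and $B$ are graded Morita equivalent if there are functors $\phi:\operatorname{Gr-}A\to\operatorname{Gr-}B$ and $\psi:\operatorname{Gr-}B\to\operatorname{Gr-}A$ that commute with all the shift functors, with $\psi\phi\cong 1$ and $\phi\psi\cong 1$ (natural isomorphisms). Then: 1. The element $p=\sum_{u\in E^0,\,u\ne v}u$ is a full homogeneous idempotent of $\mathcal L(E)$: $p^2=p$, $p$ has degree $0$ and $\mathcal L(E)\,p\,\mathcal L(E)=\mathcal L(E)$. The assignment $u\mapsto u$, $\alpha\mapsto\alpha$, $\alpha^*\mapsto\alpha^*$ induces an isomorphism of $\mathbb Z$-graded $K$-algebras $\mathcal L(E_{\backslash v})\cong p\,\mathcal L(E)\,p$. 2. $\mathcal L(E_{\backslash v})$ is graded Morita equivalent to $\mathcal L(E)$. 3. Consequently, $\mathcal L(E_{\backslash v})$ is Morita equivalent to $\mathcal L(E)$: there is a $K$-linear equivalence between their categories of right modules. -/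

import Mathlib

universe u v w m

open CategoryTheory

/-! ## Graded right modules and graded Morita equivalence -/

section GradedMorita

variable {Γ : Type v} [AddCommGroup Γ] [DecidableEq Γ]

/-- A `Γ`-graded right module over the ring `A` with homogeneous components `𝒜 i`.
Right `A`-modules are modules over `Aᵐᵒᵖ`: `MulOpposite.op a • x` is `x · a`. -/
structure GrMod {A : Type u} [Ring A] {σ : Type w} [SetLike σ A] (𝒜 : Γ → σ) where
  carrier : Type m
  [addCommGroup : AddCommGroup carrier]
  [module : Module Aᵐᵒᵖ carrier]
  deg : Γ → AddSubgroup carrier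
  isInternal : DirectSum.IsInternal deg
  smul_mem : ∀ {i j : Γ} {x : carrier} {a : A},
    x ∈ deg i → a ∈ 𝒜 j → MulOpposite.op a • x ∈ deg (i + j)

attribute [instance] GrMod.addCommGroup GrMod.module

namespace GrMod

variable {A : Type u} [Ring A] {σ : Type w} [SetLike σ A] {𝒜 : Γ → σ}

/-- Graded homomorphisms: module homomorphisms that preserve degrees. -/
@[ext]
structure Hom (M N : GrMod.{u, v, w, m} 𝒜) where
  toLin : M.carrier →ₗ[Aᵐᵒᵖ] N.carrier
  map_deg : ∀ (i : Γ) (x : M.carrier), x ∈ M.deg i → toLin x ∈ N.deg i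

/-- The category `Gr A` of graded right modules. -/
instance : Category (GrMod.{u, v, w, m} 𝒜) where
  Hom := Hom
  id M := ⟨LinearMap.id, fun _ _ h => h⟩
  comp f g := ⟨g.toLin.comp f.toLin, fun i x h => g.map_deg i _ (f.map_deg i x h)⟩

/-- The shifted grading `i ↦ deg (i + α)` is again a direct sum decomposition. -/
theorem isInternal_shift (M : GrMod.{u, v, w, m} 𝒜) (α : Γ) :
    DirectSum.IsInternal (fun i => M.deg (i + α)) := by
  have h := M.isInternal
  refine (DirectSum.isInternal_submodule_iff_iSupIndep_and_iSup_eq_top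
    (fun i => (M.deg (i + α)).toIntSubmodule)).mpr ⟨?_, ?_⟩
  · exact (DirectSum.IsInternal.submodule_iSupIndep
      (A := fun i => (M.deg i).toIntSubmodule) h).comp (add_left_injective α)
  · rw [← DirectSum.IsInternal.submodule_iSup_eq_top
      (A := fun i => (M.deg i).toIntSubmodule) h]
    exact (Equiv.addRight α).iSup_comp (g := fun i => (M.deg i).toIntSubmodule)

/-- The shift `M(α)`, with `M(α)_i = M_{i+α}`. -/
def shift (M : GrMod.{u, v, w, m} 𝒜) (α : Γ) : GrMod.{u, v, w, m} 𝒜 where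
  carrier := M.carrier
  deg i := M.deg (i + α)
  isInternal := M.isInternal_shift α
  smul_mem {i j x a} hx ha := by
    have h := M.smul_mem hx ha
    rwa [add_right_comm] at h

/-- The shift functor `𝒯_α : Gr A ⥤ Gr A`. -/
def shiftFunctor (𝒜 : Γ → σ) (α : Γ) : GrMod.{u, v, w, m} 𝒜 ⥤ GrMod.{u, v, w, m} 𝒜 where
  obj M := M.shift α
  map f := ⟨f.toLin, fun i x h => f.map_deg (i + α) x h⟩

end GrMod

variable {A : Type u} [Ring A] {σ : Type w} [SetLike σ A] {𝒜 : Γ → σ}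
  {B : Type u} [Ring B] {τ : Type w} [SetLike τ B] {ℬ : Γ → τ}

/-- A functor `Gr A ⥤ Gr B` is graded if it commutes with all shift functors. -/
def IsGradedFunctor (φ : GrMod.{u, v, w, m} 𝒜 ⥤ GrMod.{u, v, w, m} ℬ) : Prop :=
  ∀ α : Γ, GrMod.shiftFunctor 𝒜 α ⋙ φ = φ ⋙ GrMod.shiftFunctor ℬ α

/-- A graded equivalence `Gr A ⥤ Gr B`: a graded functor with a graded quasi-inverse. -/
def IsGradedEquivalence (φ : GrMod.{u, v, w, m} 𝒜 ⥤ GrMod.{u, v, w, m} ℬ) : Prop :=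
  IsGradedFunctor φ ∧ ∃ ψ : GrMod.{u, v, w, m} ℬ ⥤ GrMod.{u, v, w, m} 𝒜,
    IsGradedFunctor ψ ∧ Nonempty (φ ⋙ ψ ≅ 𝟭 _) ∧ Nonempty (ψ ⋙ φ ≅ 𝟭 _)

/-- The `Γ`-graded rings `A = ⨁ 𝒜 i` and `B = ⨁ ℬ i` are graded Morita equivalent. -/
def IsGradedMoritaEquivalent {Γ : Type v} [AddCommGroup Γ] [DecidableEq Γ]
    {A : Type u} [Ring A] {σ : Type w} [SetLike σ A] [AddSubgroupClass σ A]
    (𝒜 : Γ → σ) [GradedRing 𝒜]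
    {B : Type u} [Ring B] {τ : Type w} [SetLike τ B] [AddSubgroupClass τ B]
    (ℬ : Γ → τ) [GradedRing ℬ] : Prop :=
  ∃ φ : GrMod.{u, v, w, u} 𝒜 ⥤ GrMod.{u, v, w, u} ℬ, IsGradedEquivalence φ

/-- `p` is a full homogeneous idempotent of degree `0` in the graded ring `A = ⨁ 𝒜 i`: the two-sided
ideal `A p A` generated by `p` is all of `A`. -/
def IsFullHomogeneousIdempotent {Γ : Type v} [AddCommGroup Γ] {A : Type u} [Ring A] {σ : Type w}
    [SetLike σ A] (𝒜 : Γ → σ) (p : A) : Prop :=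
  IsIdempotentElem p ∧ p ∈ 𝒜 0 ∧ TwoSidedIdeal.span {p} = ⊤

/-- The `K`-linear multiplicative map `φ : B → A` is a graded isomorphism of `B` onto the corner
`p A p` of `A`, whose homogeneous components are `p A p ∩ 𝒜 i`. The identity of the corner is `p`, so
`φ` is not required to preserve `1`. -/
def IsGradedIsoOntoCorner {Γ : Type v} {K : Type u} [Field K]
    {A : Type w} [Ring A] [Algebra K A] (𝒜 : Γ → Submodule K A)
    {B : Type m} [Ring B] [Algebra K B] (ℬ : Γ → Submodule K B)
    (p : A) (φ : B →ₙₐ[K] A) : Prop :=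
  Function.Injective φ ∧ Set.range φ = {x | ∃ a : A, x = p * a * p} ∧
    ∀ (i : Γ) (b : B), b ∈ ℬ i ↔ φ b ∈ 𝒜 i

end GradedMorita

/-! ## Directed graphs -/

/-- A directed graph with vertices `V` and edges `Ed` (loops and multiple edges allowed). -/
structure DirectedGraph (V : Type v) (Ed : Type w) where
  s : Ed → V
  r : Ed → V

namespace DirectedGraph

variable {V : Type v} {Ed : Type w} (E : DirectedGraph V Ed)

/-- A source receives no edges. -/
def IsSource (x : V) : Prop := ∀ e : Ed, E.r e ≠ x

/-- A sink emits no edges. -/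
def IsSink (x : V) : Prop := ∀ e : Ed, E.s e ≠ x

/-- Source elimination: remove the source `x` and all the edges emitted by `x`. -/
def removeSource {x : V} (hx : E.IsSource x) :
    DirectedGraph {y : V // y ≠ x} {e : Ed // E.s e ≠ x} where
  s e := ⟨E.s e.1, e.2⟩
  r e := ⟨E.r e.1, hx e.1⟩

/-! ## Leavitt path algebras -/

/-- The generators of a Leavitt path algebra: vertices `x`, edges `e`, ghost edges `e*`. -/
inductive Gen (V : Type v) (Ed : Type w) : Type (max v w)
  | vertex (x : V)
  | edge (e : Ed)
  | ghost (e : Ed)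

/-- The degrees of the generators in the standard `ℤ`-grading. -/
def Gen.degree : Gen V Ed → ℤ
  | .vertex _ => 0
  | .edge _ => 1
  | .ghost _ => -1

section LPA

variable (K : Type u) [Field K] [Fintype V] [DecidableEq V] [Fintype Ed]

/-- The word of length one given by a generator. -/
def word (g : Gen V Ed) : FreeAlgebra K (Gen V Ed) := FreeAlgebra.ι K g

open Gen in
/-- The defining relations of the Leavitt path algebra of a finite graph. The free algebra is taken
unital, and `unit` states that its identity is the sum of the vertices; that sum is the identity
element of the algebra presented, without identity, by the other relations. -/
inductive LeavittRel : FreeAlgebra K (Gen V Ed) → FreeAlgebra K (Gen V Ed) → Prop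
  | vertex_mul_self (x : V) :
      LeavittRel (word K (vertex x) * word K (vertex x)) (word K (vertex x))
  | vertex_mul_of_ne (x y : V) (h : x ≠ y) :
      LeavittRel (word K (vertex x) * word K (vertex y)) 0
  | source_mul_edge (e : Ed) :
      LeavittRel (word K (vertex (E.s e)) * word K (edge e)) (word K (edge e))
  | edge_mul_range (e : Ed) :
      LeavittRel (word K (edge e) * word K (vertex (E.r e))) (word K (edge e))
  | range_mul_ghost (e : Ed) :
      LeavittRel (word K (vertex (E.r e)) * word K (ghost e)) (word K (ghost e))
  | ghost_mul_source (e : Ed) :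
      LeavittRel (word K (ghost e) * word K (vertex (E.s e))) (word K (ghost e))
  | ghost_mul_edge_self (e : Ed) :
      LeavittRel (word K (ghost e) * word K (edge e)) (word K (vertex (E.r e)))
  | ghost_mul_edge_of_ne (e f : Ed) (h : e ≠ f) :
      LeavittRel (word K (ghost e) * word K (edge f)) 0
  | sum_edge_mul_ghost (x : V) (h : ¬ E.IsSink x) :
      LeavittRel (∑ e : Ed with E.s e = x, word K (edge e) * word K (ghost e)) (word K (vertex x))
  | unit : LeavittRel (∑ x : V, word K (vertex x)) 1

/-- The Leavitt path algebra `L_K(E)` of a finite graph `E`. -/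
def Leavitt : Type (max u v w) := RingQuot (E.LeavittRel K)

noncomputable instance : Ring (E.Leavitt K) := inferInstanceAs (Ring (RingQuot (E.LeavittRel K)))

noncomputable instance : Algebra K (E.Leavitt K) :=
  inferInstanceAs (Algebra K (RingQuot (E.LeavittRel K)))

/-- The class of a generator in `L_K(E)`. -/
noncomputable def gen (g : Gen V Ed) : E.Leavitt K :=
  (RingQuot.mkAlgHom K (E.LeavittRel K) (word K g) : RingQuot (E.LeavittRel K))

/-- The homogeneous component of degree `k` of `L_K(E)` in the standard `ℤ`-grading: the span of the
products of generators of total degree `k`. -/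
noncomputable def grading (k : ℤ) : Submodule K (E.Leavitt K) :=
  Submodule.span K {x | ∃ l : List (Gen V Ed),
    (l.map Gen.degree).sum = k ∧ x = (l.map (E.gen K)).prod}

theorem prod_mem_grading (l : List (Gen V Ed)) :
    (l.map (E.gen K)).prod ∈ E.grading K (l.map Gen.degree).sum :=
  Submodule.subset_span ⟨l, rfl, rfl⟩

theorem gen_mem_grading (g : Gen V Ed) : E.gen K g ∈ E.grading K g.degree :=
  Submodule.subset_span ⟨[g], by simp, by simp⟩

instance : SetLike.GradedMonoid (E.grading K) where
  one_mem := Submodule.subset_span ⟨[], by simp, by simp⟩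
  mul_mem i j a b ha hb := by
    have h := Submodule.mul_mem_mul ha hb
    rw [grading, grading, Submodule.span_mul_span] at h
    refine Submodule.span_mono ?_ h
    rintro _ ⟨_, ⟨l, rfl, rfl⟩, _, ⟨l', rfl, rfl⟩, rfl⟩
    exact ⟨l ++ l', by simp, by simp⟩

open DirectSum in
/-- A generator, as an element of the direct sum of the homogeneous components. -/
noncomputable def genGraded (g : Gen V Ed) : ⨁ k, E.grading K k :=
  DirectSum.of (fun k => E.grading K k) g.degree ⟨E.gen K g, E.gen_mem_grading K g⟩

theorem gen_rel {a b : FreeAlgebra K (Gen V Ed)} (h : E.LeavittRel K a b) :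
    FreeAlgebra.lift K (E.gen K) a = FreeAlgebra.lift K (E.gen K) b := by
  have key : FreeAlgebra.lift K (E.gen K) = RingQuot.mkAlgHom K (E.LeavittRel K) := by
    ext g
    exact FreeAlgebra.lift_ι_apply _ _
  rw [key]
  exact RingQuot.mkAlgHom_rel K h

theorem genGraded_mul_eq (g g' k : Gen V Ed) (hd : g.degree + g'.degree = k.degree)
    (h : E.gen K g * E.gen K g' = E.gen K k) :
    E.genGraded K g * E.genGraded K g' = E.genGraded K k := by
  unfold genGraded
  rw [DirectSum.of_mul_of]
  exact DirectSum.of_eq_of_gradedMonoid_eq (Sigma.subtype_ext hd h)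

theorem genGraded_mul_eq_zero (g g' : Gen V Ed) (h : E.gen K g * E.gen K g' = 0) :
    E.genGraded K g * E.genGraded K g' = 0 := by
  unfold genGraded
  rw [DirectSum.of_mul_of]
  refine (congrArg _ (Subtype.ext h)).trans (map_zero _)

theorem edge_mul_ghost (e : Ed)
    (h : E.gen K (.edge e) * E.gen K (.ghost e) ∈ E.grading K 0) :
    E.genGraded K (.edge e) * E.genGraded K (.ghost e) =
      DirectSum.of (fun k => E.grading K k) 0 ⟨_, h⟩ := by
  unfold genGraded
  rw [DirectSum.of_mul_of]
  exact DirectSum.of_eq_of_gradedMonoid_eq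
    (Sigma.subtype_ext (add_neg_cancel (1 : ℤ)) rfl)

theorem sum_of_eq {ι : Type*} (t : Finset ι) (f : ι → E.Leavitt K) {y : E.Leavitt K} {k : ℤ}
    (hf : ∀ i, f i ∈ E.grading K k) (hy : y ∈ E.grading K k) (h : ∑ i ∈ t, f i = y) :
    ∑ i ∈ t, DirectSum.of (fun k => E.grading K k) k ⟨f i, hf i⟩ =
      DirectSum.of (fun k => E.grading K k) k ⟨y, hy⟩ := by
  rw [← map_sum]
  refine congrArg (DirectSum.of (fun k => E.grading K k) k) (Subtype.ext ?_)
  rw [AddSubmonoidClass.coe_finsetSum]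
  exact h

theorem genGraded_rel {a b : FreeAlgebra K (Gen V Ed)} (h : E.LeavittRel K a b) :
    FreeAlgebra.lift K (E.genGraded K) a = FreeAlgebra.lift K (E.genGraded K) b := by
  have h' := E.gen_rel K h
  cases h with
  | vertex_mul_of_ne x y h =>
    simp only [word, map_mul, FreeAlgebra.lift_ι_apply, map_zero] at h' ⊢
    exact E.genGraded_mul_eq_zero K _ _ h'
  | ghost_mul_edge_of_ne e f h =>
    simp only [word, map_mul, FreeAlgebra.lift_ι_apply, map_zero] at h' ⊢
    exact E.genGraded_mul_eq_zero K _ _ h'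
  | sum_edge_mul_ghost x h =>
    simp only [word, map_mul, map_sum, FreeAlgebra.lift_ι_apply] at h' ⊢
    have hm : ∀ e : Ed, E.gen K (.edge e) * E.gen K (.ghost e) ∈ E.grading K 0 := by
      intro e
      have h := SetLike.mul_mem_graded (E.gen_mem_grading K (.edge e))
        (E.gen_mem_grading K (.ghost e))
      rwa [show (Gen.edge e : Gen V Ed).degree + (Gen.ghost e : Gen V Ed).degree = 0 from
        add_neg_cancel (1 : ℤ)] at h
    have h0 := fun e => E.edge_mul_ghost K e (hm e)
    rw [Finset.sum_congr rfl (fun e _ => h0 e)]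
    exact E.sum_of_eq K _ _ hm (E.gen_mem_grading K (.vertex x)) h'
  | unit =>
    simp only [word, map_sum, map_one, FreeAlgebra.lift_ι_apply] at h' ⊢
    exact E.sum_of_eq K _ _ (fun x => E.gen_mem_grading K (.vertex x))
      (SetLike.GradedOne.one_mem (A := E.grading K)) h'
  | vertex_mul_self x =>
    simp only [word, map_mul, FreeAlgebra.lift_ι_apply] at h' ⊢
    exact E.genGraded_mul_eq K _ _ _ rfl h'
  | source_mul_edge e =>
    simp only [word, map_mul, FreeAlgebra.lift_ι_apply] at h' ⊢
    exact E.genGraded_mul_eq K _ _ _ rfl h'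
  | edge_mul_range e =>
    simp only [word, map_mul, FreeAlgebra.lift_ι_apply] at h' ⊢
    exact E.genGraded_mul_eq K _ _ _ rfl h'
  | range_mul_ghost e =>
    simp only [word, map_mul, FreeAlgebra.lift_ι_apply] at h' ⊢
    exact E.genGraded_mul_eq K _ _ _ rfl h'
  | ghost_mul_source e =>
    simp only [word, map_mul, FreeAlgebra.lift_ι_apply] at h' ⊢
    exact E.genGraded_mul_eq K _ _ _ rfl h'
  | ghost_mul_edge_self e =>
    simp only [word, map_mul, FreeAlgebra.lift_ι_apply] at h' ⊢
    exact E.genGraded_mul_eq K _ _ _ rfl h'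

open DirectSum in
/-- The decomposition of an element of `L_K(E)` into homogeneous components. -/
noncomputable def decomposeHom : E.Leavitt K →ₐ[K] ⨁ k, E.grading K k :=
  RingQuot.liftAlgHom K (s := E.LeavittRel K)
    ⟨FreeAlgebra.lift K (E.genGraded K), fun _ _ h => E.genGraded_rel K h⟩

theorem decomposeHom_gen (g : Gen V Ed) : E.decomposeHom K (E.gen K g) = E.genGraded K g := by
  refine (RingQuot.liftAlgHom_mkAlgHom_apply K _ _ _).trans ?_
  simp [word]

theorem decomposeHom_prod (l : List (Gen V Ed)) :
    E.decomposeHom K (l.map (E.gen K)).prod =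
      DirectSum.of (fun k => E.grading K k) (l.map Gen.degree).sum
        ⟨(l.map (E.gen K)).prod, E.prod_mem_grading K l⟩ := by
  induction l with
  | nil => exact map_one _
  | cons g l ih =>
    have h1 : (List.map (E.gen K) (g :: l)).prod = E.gen K g * (l.map (E.gen K)).prod := by simp
    refine (congrArg (E.decomposeHom K) h1).trans ?_
    rw [map_mul, ih, decomposeHom_gen, genGraded, DirectSum.of_mul_of]
    exact DirectSum.of_eq_of_gradedMonoid_eq (Sigma.subtype_ext rfl h1.symm)

/-- The standard `ℤ`-grading of `L_K(E)`. -/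
noncomputable instance : GradedAlgebra (E.grading K) :=
  GradedAlgebra.ofAlgHom (E.grading K) (E.decomposeHom K)
    (by
      refine RingQuot.ringQuot_ext' K _ _ ?_
      ext g
      refine (congrArg (DirectSum.coeAlgHom (E.grading K)) (E.decomposeHom_gen K g)).trans ?_
      exact DirectSum.coeAlgHom_of _ _ _)
    (by
      rintro k ⟨x, hx⟩
      refine Submodule.span_induction (p := fun x hx => E.decomposeHom K x =
        DirectSum.of (fun k => E.grading K k) k ⟨x, hx⟩) ?_ ?_ ?_ ?_ hx
      · rintro _ ⟨l, rfl, rfl⟩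
        exact E.decomposeHom_prod K l
      · rw [map_zero]
        exact (map_zero (DirectSum.of (fun k => E.grading K k) k)).symm
      · intro x y hx hy h h'
        rw [map_add, h, h', ← map_add]
        rfl
      · intro c x hx h
        rw [map_smul, h]
        exact (map_smul (DirectSum.lof K ℤ (fun k => E.grading K k) k) c ⟨x, hx⟩).symm)

end LPA

end DirectedGraph

/-! Write `A` and `B` for the Leavitt path algebras of the given graph and of the graph without the
source `x`, and `p` for the sum of the vertices other than `x`. The generators of `B`, read in `A`,
satisfy every relation except that their vertices add up to `p` instead of `1`. Hence they define a
homomorphism `B → A` with `1 ↦ p` (`IsLeavittFamily.lift`, `removeSourceHom`).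

Its image is `p A p`: a word that starts and ends outside `x` can enter `x` only through a ghost
edge `e*` with `s(e) = x`, and it leaves through `e* e = r(e)` or vanishes (`corner_subset_range`).
For injectivity, `A p` should be `B ⊕ ⨁ r(e) B`, summed over the edges `e` emitted by `x`. The
matrices of left multiplication on this module represent `A` over `B`, and one entry recovers the
element of `B` (`lift_sourceMatrix_removeSourceHom`). An injective graded map reflects degrees, so
the isomorphism onto the corner is graded.

No edge ends at `x`, so every edge lies in `A p` and every ghost edge in `p A`. As `x` emits an
edge, `x = ∑ e e*`, and `1 = ∑ y y + ∑ e e*` writes `1` as a finite sum of products from `A p` and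
`p A` with factors of opposite degrees. This is the data of `FullCorner` and `FullCorner.IsGraded`.
For such data `M ↦ M p` and `N ↦ Hom_B(A p, N)` are inverse equivalences, because the factors of `1`
act as a dual basis of `A p` (`unitEquiv`, `counitEquiv`); both preserve gradings and commute with
shifts. -/

/-! ## Corner algebras -/

section Corner

variable {K : Type*} [Field K] {C : Type*} [Ring C] [Algebra K C] {e : C}

theorem IsIdempotentElem.mem_corner_iff (he : IsIdempotentElem e) {c : C} :
    c ∈ Subsemigroup.corner e ↔ e * c = c ∧ c * e = c :=
  Subsemigroup.mem_corner_iff he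

instance IsIdempotentElem.cornerSMul (he : IsIdempotentElem e) : SMul K he.Corner where
  smul k c := ⟨k • c.1, he.mem_corner_iff.2 ⟨by
    rw [mul_smul_comm, (he.mem_corner_iff.1 c.2).1], by
    rw [smul_mul_assoc, (he.mem_corner_iff.1 c.2).2]⟩⟩

instance IsIdempotentElem.cornerModule (he : IsIdempotentElem e) : Module K he.Corner where
  one_smul c := Subtype.ext (one_smul K c.1)
  mul_smul k l c := Subtype.ext (mul_smul k l c.1)
  smul_zero k := Subtype.ext (smul_zero k)
  smul_add k c d := Subtype.ext (smul_add k c.1 d.1)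
  add_smul k l c := Subtype.ext (add_smul k l c.1)
  zero_smul c := Subtype.ext (zero_smul K c.1)

/-- The identity of the corner is `e`, so `algebraMap` sends `k` to `k • e`. -/
instance IsIdempotentElem.cornerAlgebra (he : IsIdempotentElem e) : Algebra K he.Corner :=
  Algebra.ofModule
    (fun k c d => Subtype.ext (smul_mul_assoc k c.1 d.1))
    (fun k c d => Subtype.ext (mul_smul_comm k c.1 d.1))

/-- The inclusion of a corner, a homomorphism of algebras without identity. -/
def IsIdempotentElem.cornerSubtype (K : Type*) [Field K] [Algebra K C]
    (he : IsIdempotentElem e) : he.Corner →ₙₐ[K] C where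
  toFun c := c.1
  map_smul' _ _ := rfl
  map_zero' := rfl
  map_add' _ _ := rfl
  map_mul' _ _ := rfl

end Corner

namespace DirectedGraph

variable {V : Type v} {Ed : Type w} (E : DirectedGraph V Ed)
  (K : Type u) [Field K] [Fintype V] [DecidableEq V] [Fintype Ed]

/-! ## The universal property of Leavitt path algebras without identity -/

/-- A family of elements of a ring that satisfies the relations of the Leavitt path algebra, except
possibly that the vertices add up to the identity. -/
structure IsLeavittFamily {C : Type m} [Ring C] (f : Gen V Ed → C) : Prop where
  vertex_mul_self (x : V) : f (.vertex x) * f (.vertex x) = f (.vertex x)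
  vertex_mul_of_ne (x y : V) (h : x ≠ y) : f (.vertex x) * f (.vertex y) = 0
  source_mul_edge (e : Ed) : f (.vertex (E.s e)) * f (.edge e) = f (.edge e)
  edge_mul_range (e : Ed) : f (.edge e) * f (.vertex (E.r e)) = f (.edge e)
  range_mul_ghost (e : Ed) : f (.vertex (E.r e)) * f (.ghost e) = f (.ghost e)
  ghost_mul_source (e : Ed) : f (.ghost e) * f (.vertex (E.s e)) = f (.ghost e)
  ghost_mul_edge_self (e : Ed) : f (.ghost e) * f (.edge e) = f (.vertex (E.r e))
  ghost_mul_edge_of_ne (e e' : Ed) (h : e ≠ e') : f (.ghost e) * f (.edge e') = 0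
  sum_edge_mul_ghost (x : V) (h : ¬ E.IsSink x) :
    ∑ e : Ed with E.s e = x, f (.edge e) * f (.ghost e) = f (.vertex x)

namespace IsLeavittFamily

variable {E} {C : Type m} [Ring C] {f : Gen V Ed → C} (hf : E.IsLeavittFamily f)
include hf

theorem sum_mul_vertex (x : V) : (∑ y, f (.vertex y)) * f (.vertex x) = f (.vertex x) := by
  rw [Finset.sum_mul, Finset.sum_eq_single x (fun y _ h => hf.vertex_mul_of_ne y x h) (by simp),
    hf.vertex_mul_self]

theorem vertex_mul_sum (x : V) : f (.vertex x) * (∑ y, f (.vertex y)) = f (.vertex x) := by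
  rw [Finset.mul_sum, Finset.sum_eq_single x (fun y _ h => hf.vertex_mul_of_ne x y h.symm) (by simp),
    hf.vertex_mul_self]

/-- Each generator absorbs a vertex on either side. With `mul_sum` this puts the whole family into
the corner cut out by the vertex sum, where that sum is the identity. -/
theorem sum_mul (g : Gen V Ed) : (∑ y, f (.vertex y)) * f g = f g := by
  cases g with
  | vertex x => exact hf.sum_mul_vertex x
  | edge e => rw [← hf.source_mul_edge, ← mul_assoc, hf.sum_mul_vertex]
  | ghost e => rw [← hf.range_mul_ghost, ← mul_assoc, hf.sum_mul_vertex]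

theorem mul_sum (g : Gen V Ed) : f g * (∑ y, f (.vertex y)) = f g := by
  cases g with
  | vertex x => exact hf.vertex_mul_sum x
  | edge e => rw [← hf.edge_mul_range, mul_assoc, hf.vertex_mul_sum]
  | ghost e => rw [← hf.ghost_mul_source, mul_assoc, hf.vertex_mul_sum]

theorem isIdempotentElem_sum : IsIdempotentElem (∑ y, f (.vertex y)) := by
  rw [IsIdempotentElem, Finset.mul_sum]
  exact Finset.sum_congr rfl fun y _ => hf.sum_mul_vertex y

/-- A Leavitt family, as a family of elements of the corner cut out by the sum of its vertices. -/
def toCorner (g : Gen V Ed) : hf.isIdempotentElem_sum.Corner :=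
  ⟨f g, hf.isIdempotentElem_sum.mem_corner_iff.2 ⟨hf.sum_mul g, hf.mul_sum g⟩⟩

variable [Algebra K C]

theorem lift_toCorner_rel {a b : FreeAlgebra K (Gen V Ed)} (h : E.LeavittRel K a b) :
    FreeAlgebra.lift K hf.toCorner a = FreeAlgebra.lift K hf.toCorner b := by
  have coe_sum : ∀ (t : Finset Ed) (F : Ed → hf.isIdempotentElem_sum.Corner),
      (∑ i ∈ t, F i).1 = ∑ i ∈ t, (F i).1 := fun t F =>
    map_sum (hf.isIdempotentElem_sum.cornerSubtype K) F t
  have coe_sum' : ∀ (t : Finset V) (F : V → hf.isIdempotentElem_sum.Corner),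
      (∑ i ∈ t, F i).1 = ∑ i ∈ t, (F i).1 := fun t F =>
    map_sum (hf.isIdempotentElem_sum.cornerSubtype K) F t
  cases h <;> simp only [word, map_mul, map_sum, map_one, map_zero, FreeAlgebra.lift_ι_apply] <;>
    apply Subtype.ext
  case vertex_mul_self x => exact hf.vertex_mul_self x
  case vertex_mul_of_ne x y h => exact hf.vertex_mul_of_ne x y h
  case source_mul_edge e => exact hf.source_mul_edge e
  case edge_mul_range e => exact hf.edge_mul_range e
  case range_mul_ghost e => exact hf.range_mul_ghost e
  case ghost_mul_source e => exact hf.ghost_mul_source e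
  case ghost_mul_edge_self e => exact hf.ghost_mul_edge_self e
  case ghost_mul_edge_of_ne e e' h => exact hf.ghost_mul_edge_of_ne e e' h
  case sum_edge_mul_ghost x h => exact (coe_sum _ _).trans (hf.sum_edge_mul_ghost x h)
  -- The identity of the corner is by definition the vertex sum.
  case unit => exact coe_sum' _ _

/-- The homomorphism to the corner that is given by a Leavitt family. -/
noncomputable def liftCorner : E.Leavitt K →ₐ[K] hf.isIdempotentElem_sum.Corner :=
  RingQuot.liftAlgHom K (s := E.LeavittRel K)
    ⟨FreeAlgebra.lift K hf.toCorner, fun _ _ h => hf.lift_toCorner_rel K h⟩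

/-- The homomorphism of algebras without identity that is given by a Leavitt family. -/
noncomputable def lift : E.Leavitt K →ₙₐ[K] C :=
  (hf.isIdempotentElem_sum.cornerSubtype K).comp
    (hf.liftCorner K : E.Leavitt K →ₙₐ[K] hf.isIdempotentElem_sum.Corner)

theorem lift_gen (g : Gen V Ed) : hf.lift K (E.gen K g) = f g := by
  refine congrArg Subtype.val (a₂ := hf.toCorner g)
    ((RingQuot.liftAlgHom_mkAlgHom_apply K _ _ _).trans ?_)
  simp [word]

theorem lift_one : hf.lift K 1 = ∑ y, f (.vertex y) :=
  congrArg Subtype.val (map_one (hf.liftCorner K))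

end IsLeavittFamily

theorem isLeavittFamily_gen : E.IsLeavittFamily (E.gen K) := by
  constructor
  all_goals intros
  case vertex_mul_self x => simpa [word] using E.gen_rel K (.vertex_mul_self x)
  case vertex_mul_of_ne x y h => simpa [word] using E.gen_rel K (.vertex_mul_of_ne x y h)
  case source_mul_edge e => simpa [word] using E.gen_rel K (.source_mul_edge e)
  case edge_mul_range e => simpa [word] using E.gen_rel K (.edge_mul_range e)
  case range_mul_ghost e => simpa [word] using E.gen_rel K (.range_mul_ghost e)
  case ghost_mul_source e => simpa [word] using E.gen_rel K (.ghost_mul_source e)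
  case ghost_mul_edge_self e => simpa [word] using E.gen_rel K (.ghost_mul_edge_self e)
  case ghost_mul_edge_of_ne e f h => simpa [word] using E.gen_rel K (.ghost_mul_edge_of_ne e f h)
  case sum_edge_mul_ghost x h => simpa [word] using E.gen_rel K (.sum_edge_mul_ghost x h)

theorem sum_vertex : ∑ y, E.gen K (.vertex y) = 1 := by
  simpa [word] using E.gen_rel K .unit

/-- The products of generators span the Leavitt path algebra. -/
theorem leavitt_induction {P : E.Leavitt K → Prop} (one : P 1)
    (gen_mul : ∀ g a, P a → P (E.gen K g * a)) (add : ∀ a b, P a → P b → P (a + b))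
    (smul : ∀ (k : K) a, P a → P (k • a)) (a : E.Leavitt K) : P a := by
  have hprod : ∀ l : List (Gen V Ed), P (l.map (E.gen K)).prod := by
    intro l
    induction l with
    | nil => simpa using one
    | cons g l ih => simpa using gen_mul g _ ih
  have hhom : ∀ k, ∀ b ∈ E.grading K k, P b := by
    intro k b hb
    induction hb using Submodule.span_induction with
    | mem b hb =>
      obtain ⟨l, -, rfl⟩ := hb
      exact hprod l
    -- Zero is obtained as `0 • 1`.
    | zero => simpa using smul 0 1 one
    | add b c _ _ hb hc => exact add b c hb hc
    | smul k b _ hb => exact smul k b hb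
  induction a using DirectSum.Decomposition.inductionOn (E.grading K) with
  | zero => simpa using smul 0 1 one
  | homogeneous b => exact hhom _ _ b.2
  | add b c hb hc => exact add b c hb hc

end DirectedGraph

namespace DirectedGraph

variable {V : Type v} {Ed : Type w} (E : DirectedGraph V Ed)
  (K : Type u) [Field K] [Fintype V] [DecidableEq V] [Fintype Ed]
  {x : V} (hx : E.IsSource x)

/-! ## Source elimination -/

/-- The generators that remain after the removal of a source, as generators of the big algebra. -/
def Gen.ofRemoveSource : Gen {y : V // y ≠ x} {e : Ed // E.s e ≠ x} → Gen V Ed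
  | .vertex y => .vertex y.1
  | .edge e => .edge e.1
  | .ghost e => .ghost e.1

omit [Fintype V] [DecidableEq V] [Fintype Ed] in
theorem Gen.degree_ofRemoveSource (g : Gen {y : V // y ≠ x} {e : Ed // E.s e ≠ x}) :
    (g.ofRemoveSource E).degree = g.degree := by
  cases g <;> rfl

/-- Only edges emitted by `x` are deleted, so a vertex other than `x` emits the same edges in both
graphs and its summation relation is unchanged. -/
theorem isLeavittFamily_ofRemoveSource :
    (E.removeSource hx).IsLeavittFamily fun g => E.gen K (g.ofRemoveSource E) where
  vertex_mul_self y := (E.isLeavittFamily_gen K).vertex_mul_self y.1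
  vertex_mul_of_ne y z h := (E.isLeavittFamily_gen K).vertex_mul_of_ne y.1 z.1
    fun h' => h (Subtype.ext h')
  source_mul_edge e := (E.isLeavittFamily_gen K).source_mul_edge e.1
  edge_mul_range e := (E.isLeavittFamily_gen K).edge_mul_range e.1
  range_mul_ghost e := (E.isLeavittFamily_gen K).range_mul_ghost e.1
  ghost_mul_source e := (E.isLeavittFamily_gen K).ghost_mul_source e.1
  ghost_mul_edge_self e := (E.isLeavittFamily_gen K).ghost_mul_edge_self e.1
  ghost_mul_edge_of_ne e e' h := (E.isLeavittFamily_gen K).ghost_mul_edge_of_ne e.1 e'.1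
    fun h' => h (Subtype.ext h')
  sum_edge_mul_ghost y hy := by
    have hy' : ¬ E.IsSink y.1 := fun h => hy fun e he => h e.1 (congrArg Subtype.val he)
    refine Eq.trans ?_ ((E.isLeavittFamily_gen K).sum_edge_mul_ghost y.1 hy')
    refine Finset.sum_bij (fun e _ => e.1) ?_ (fun _ _ _ _ h => Subtype.ext h) ?_ fun _ _ => rfl
    · intro e he
      exact Finset.mem_filter.2 ⟨Finset.mem_univ _, congrArg Subtype.val (Finset.mem_filter.1 he).2⟩
    · intro e he
      have he' : E.s e = y.1 := by simpa using he
      exact ⟨⟨e, he' ▸ y.2⟩, by simpa using Subtype.ext he', rfl⟩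

/-- The homomorphism of Leavitt path algebras induced by the inclusion of the graph that is left
after the removal of a source. -/
noncomputable def removeSourceHom : (E.removeSource hx).Leavitt K →ₙₐ[K] E.Leavitt K :=
  (E.isLeavittFamily_ofRemoveSource K hx).lift K

theorem removeSourceHom_gen (g : Gen {y : V // y ≠ x} {e : Ed // E.s e ≠ x}) :
    E.removeSourceHom K hx ((E.removeSource hx).gen K g) = E.gen K (g.ofRemoveSource E) :=
  (E.isLeavittFamily_ofRemoveSource K hx).lift_gen K g

variable (x) in
/-- The sum of the vertices other than `x`. -/
noncomputable def sumNe : E.Leavitt K := ∑ y : V with y ≠ x, E.gen K (.vertex y)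

theorem removeSourceHom_one : E.removeSourceHom K hx 1 = E.sumNe K x := by
  refine ((E.isLeavittFamily_ofRemoveSource K hx).lift_one K).trans ?_
  exact (Finset.sum_subtype _ (by simp) fun y => E.gen K (.vertex y)).symm

theorem sumNe_add_vertex : E.sumNe K x + E.gen K (.vertex x) = 1 := by
  rw [← E.sum_vertex K, sumNe, ← Finset.sum_filter_add_sum_filter_not Finset.univ (· ≠ x)]
  simp only [ne_eq, not_not, Finset.filter_eq', Finset.mem_univ, if_true, Finset.sum_singleton]

theorem sumNe_mul_vertex_self : E.sumNe K x * E.gen K (.vertex x) = 0 := by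
  rw [sumNe, Finset.sum_mul]
  exact Finset.sum_eq_zero fun y hy =>
    (E.isLeavittFamily_gen K).vertex_mul_of_ne y x (by simpa using hy)

theorem vertex_self_mul_sumNe : E.gen K (.vertex x) * E.sumNe K x = 0 := by
  rw [sumNe, Finset.mul_sum]
  exact Finset.sum_eq_zero fun y hy =>
    (E.isLeavittFamily_gen K).vertex_mul_of_ne x y (Ne.symm (by simpa using hy))

theorem isIdempotentElem_sumNe : IsIdempotentElem (E.sumNe K x) := by
  have h := congrArg (E.sumNe K x * ·) (E.sumNe_add_vertex K (x := x))
  simpa [mul_add, sumNe_mul_vertex_self, IsIdempotentElem] using h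

theorem sumNe_mul_vertex {y : V} (hy : y ≠ x) :
    E.sumNe K x * E.gen K (.vertex y) = E.gen K (.vertex y) := by
  have h := congrArg (· * E.gen K (.vertex y)) (E.sumNe_add_vertex K (x := x))
  simpa [add_mul, (E.isLeavittFamily_gen K).vertex_mul_of_ne x y hy.symm] using h

theorem vertex_mul_sumNe {y : V} (hy : y ≠ x) :
    E.gen K (.vertex y) * E.sumNe K x = E.gen K (.vertex y) := by
  have h := congrArg (E.gen K (.vertex y) * ·) (E.sumNe_add_vertex K (x := x))
  simpa [mul_add, (E.isLeavittFamily_gen K).vertex_mul_of_ne y x hy] using h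

theorem sumNe_mul_edge {e : Ed} (he : E.s e ≠ x) :
    E.sumNe K x * E.gen K (.edge e) = E.gen K (.edge e) := by
  rw [← (E.isLeavittFamily_gen K).source_mul_edge, ← mul_assoc, E.sumNe_mul_vertex K he]

theorem sumNe_mul_edge_of_source {e : Ed} (he : E.s e = x) :
    E.sumNe K x * E.gen K (.edge e) = 0 := by
  rw [← (E.isLeavittFamily_gen K).source_mul_edge, ← mul_assoc, he, sumNe_mul_vertex_self, zero_mul]

theorem ghost_mul_sumNe {e : Ed} (he : E.s e ≠ x) :
    E.gen K (.ghost e) * E.sumNe K x = E.gen K (.ghost e) := by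
  rw [← (E.isLeavittFamily_gen K).ghost_mul_source, mul_assoc, E.vertex_mul_sumNe K he]

theorem ghost_mul_sumNe_of_source {e : Ed} (he : E.s e = x) :
    E.gen K (.ghost e) * E.sumNe K x = 0 := by
  rw [← (E.isLeavittFamily_gen K).ghost_mul_source, mul_assoc, he, vertex_self_mul_sumNe, mul_zero]

-- Here the source condition enters: `r(e) ≠ x`, so every edge lies in `A p`, and dually every ghost
-- edge lies in `p A`.
include hx in
theorem edge_mul_sumNe (e : Ed) :
    E.gen K (.edge e) * E.sumNe K x = E.gen K (.edge e) := by
  rw [← (E.isLeavittFamily_gen K).edge_mul_range, mul_assoc, E.vertex_mul_sumNe K (hx e)]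

include hx in
theorem sumNe_mul_ghost (e : Ed) :
    E.sumNe K x * E.gen K (.ghost e) = E.gen K (.ghost e) := by
  rw [← (E.isLeavittFamily_gen K).range_mul_ghost, ← mul_assoc, E.sumNe_mul_vertex K (hx e)]

theorem ghost_mul_vertex_of_ne {e : Ed} {y : V} (h : E.s e ≠ y) :
    E.gen K (.ghost e) * E.gen K (.vertex y) = 0 := by
  rw [← (E.isLeavittFamily_gen K).ghost_mul_source, mul_assoc,
    (E.isLeavittFamily_gen K).vertex_mul_of_ne _ _ h, mul_zero]

theorem ghost_mul_ghost_of_ne {e e' : Ed} (h : E.s e ≠ E.r e') :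
    E.gen K (.ghost e) * E.gen K (.ghost e') = 0 := by
  rw [← (E.isLeavittFamily_gen K).range_mul_ghost e', ← mul_assoc, E.ghost_mul_vertex_of_ne K h,
    zero_mul]

/-! ### The image is the corner -/

theorem mul_mem_range_removeSourceHom {a b : E.Leavitt K}
    (ha : a ∈ Set.range (E.removeSourceHom K hx)) (hb : b ∈ Set.range (E.removeSourceHom K hx)) :
    a * b ∈ Set.range (E.removeSourceHom K hx) := by
  obtain ⟨a, rfl⟩ := ha
  obtain ⟨b, rfl⟩ := hb
  exact ⟨a * b, map_mul _ _ _⟩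

/-- Induction on words, peeling generators off the left. The first claim does not carry itself: for
`s(e) = x`, `p e* a p = e* a p` while `e*` is not a generator of the smaller graph. The second claim
absorbs this case. After `e*`, the vertex `x` changes nothing, the edge `e` gives `r(e) a p`, and
any other generator gives zero; a ghost edge does so because `x` is not a range. -/
theorem corner_subset_range (a : E.Leavitt K) :
    E.sumNe K x * a * E.sumNe K x ∈ Set.range (E.removeSourceHom K hx) ∧
      ∀ e, E.s e = x →
        E.gen K (.ghost e) * a * E.sumNe K x ∈ Set.range (E.removeSourceHom K hx) := by
  have hf := E.isLeavittFamily_gen K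
  have hgen : ∀ g : Gen {y : V // y ≠ x} {e : Ed // E.s e ≠ x},
      E.gen K (g.ofRemoveSource E) ∈ Set.range (E.removeSourceHom K hx) :=
    fun g => ⟨_, E.removeSourceHom_gen K hx g⟩
  have hmul := fun {a b} => E.mul_mem_range_removeSourceHom K hx (a := a) (b := b)
  have zero_mem : (0 : E.Leavitt K) ∈ Set.range (E.removeSourceHom K hx) := ⟨0, map_zero _⟩
  induction a using E.leavitt_induction K with
  | one =>
    refine ⟨?_, fun e he => ?_⟩
    · rw [mul_one, (E.isIdempotentElem_sumNe K).eq]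
      exact ⟨1, E.removeSourceHom_one K hx⟩
    · rwa [mul_one, E.ghost_mul_sumNe_of_source K he]
  | add a b ha hb =>
    refine ⟨?_, fun e he => ?_⟩
    · obtain ⟨c, hc⟩ := ha.1
      obtain ⟨d, hd⟩ := hb.1
      exact ⟨c + d, by rw [map_add, hc, hd, mul_add, add_mul]⟩
    · obtain ⟨c, hc⟩ := ha.2 e he
      obtain ⟨d, hd⟩ := hb.2 e he
      exact ⟨c + d, by rw [map_add, hc, hd, mul_add, add_mul]⟩
  | smul k a ha =>
    refine ⟨?_, fun e he => ?_⟩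
    · obtain ⟨c, hc⟩ := ha.1
      exact ⟨k • c, by rw [map_smul, hc, mul_smul_comm, smul_mul_assoc]⟩
    · obtain ⟨c, hc⟩ := ha.2 e he
      exact ⟨k • c, by rw [map_smul, hc, mul_smul_comm, smul_mul_assoc]⟩
  | gen_mul g a ha =>
    obtain ⟨ha, ha'⟩ := ha
    cases g with
    | vertex y =>
      by_cases hy : y = x
      · subst hy
        refine ⟨?_, fun e he => ?_⟩
        · rwa [← mul_assoc, sumNe_mul_vertex_self, zero_mul, zero_mul]
        · have h := hf.ghost_mul_source e
          rw [he] at h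
          rw [← mul_assoc, h]
          exact ha' e he
      · refine ⟨?_, fun e he => ?_⟩
        · have h := hmul (hgen (.vertex ⟨y, hy⟩)) ha
          simp only [Gen.ofRemoveSource, ← mul_assoc, E.vertex_mul_sumNe K hy] at h
          rwa [← mul_assoc, E.sumNe_mul_vertex K hy]
        · rwa [← mul_assoc, E.ghost_mul_vertex_of_ne K (he ▸ Ne.symm hy), zero_mul, zero_mul]
    | edge e =>
      by_cases hs : E.s e = x
      · refine ⟨?_, fun e' he' => ?_⟩
        · rwa [← mul_assoc, E.sumNe_mul_edge_of_source K hs, zero_mul, zero_mul]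
        · by_cases hee : e' = e
          · subst hee
            -- `r(e')` is a vertex of the smaller graph, so `r(e') a p = r(e') (p a p)` falls under
            -- the first claim.
            have h := hmul (hgen (.vertex ⟨E.r e', hx e'⟩)) ha
            simp only [Gen.ofRemoveSource, ← mul_assoc, E.vertex_mul_sumNe K (hx e')] at h
            rwa [← mul_assoc, hf.ghost_mul_edge_self]
          · rwa [← mul_assoc, hf.ghost_mul_edge_of_ne _ _ hee, zero_mul, zero_mul]
      · refine ⟨?_, fun e' he' => ?_⟩
        · have h := hmul (hgen (.edge ⟨e, hs⟩)) ha
          simp only [Gen.ofRemoveSource, ← mul_assoc, E.edge_mul_sumNe K hx] at h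
          rwa [← mul_assoc, E.sumNe_mul_edge K hs]
        · rwa [← mul_assoc, hf.ghost_mul_edge_of_ne _ _ fun h : e' = e => hs (h ▸ he'), zero_mul, zero_mul]
    | ghost e =>
      refine ⟨?_, fun e' he' => ?_⟩
      · rw [← mul_assoc, E.sumNe_mul_ghost K hx]
        by_cases hs : E.s e = x
        -- This is the case for which the second claim is carried along.
        · exact ha' e hs
        · have h := hmul (hgen (.ghost ⟨e, hs⟩)) ha
          simpa only [Gen.ofRemoveSource, ← mul_assoc, E.ghost_mul_sumNe K hs] using h
      · rwa [← mul_assoc, E.ghost_mul_ghost_of_ne K (he' ▸ Ne.symm (hx e)), zero_mul, zero_mul]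

theorem range_removeSourceHom :
    Set.range (E.removeSourceHom K hx) = {b | ∃ a, b = E.sumNe K x * a * E.sumNe K x} := by
  ext b
  constructor
  · rintro ⟨a, rfl⟩
    refine ⟨E.removeSourceHom K hx a, ?_⟩
    rw [← E.removeSourceHom_one K hx, ← map_mul, ← map_mul, one_mul, mul_one]
  · rintro ⟨a, rfl⟩
    exact (E.corner_subset_range K hx a).1

/-! ### The homomorphism is injective -/

open Classical in
/-- The matrices over the algebra of the smaller graph by which the generators of the big algebra
act on the right module generated by the vertices other than `x`. -/
noncomputable def sourceMatrix :
    Gen V Ed → Matrix (Option Ed) (Option Ed) ((E.removeSource hx).Leavitt K)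
  | .vertex y => if h : y ≠ x then
      Matrix.single none none ((E.removeSource hx).gen K (.vertex ⟨y, h⟩))
      else ∑ e : Ed with E.s e = x, Matrix.single (some e) (some e)
        ((E.removeSource hx).gen K (.vertex ⟨E.r e, hx e⟩))
  | .edge e => if h : E.s e ≠ x then
      Matrix.single none none ((E.removeSource hx).gen K (.edge ⟨e, h⟩))
      else Matrix.single (some e) none ((E.removeSource hx).gen K (.vertex ⟨E.r e, hx e⟩))
  | .ghost e => if h : E.s e ≠ x then
      Matrix.single none none ((E.removeSource hx).gen K (.ghost ⟨e, h⟩))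
      else Matrix.single none (some e) ((E.removeSource hx).gen K (.vertex ⟨E.r e, hx e⟩))

open Classical in
theorem sum_single_mul_single {e : Ed} (he : E.s e = x) (j : Option Ed)
    (F : Ed → (E.removeSource hx).Leavitt K) (a : (E.removeSource hx).Leavitt K) :
    (∑ e' : Ed with E.s e' = x, Matrix.single (some e') (some e') (F e')) *
      Matrix.single (some e) j a = Matrix.single (some e) j (F e * a) := by
  rw [Finset.sum_mul, Finset.sum_eq_single e]
  · simp
  · intro e' _ h
    exact Matrix.single_mul_single_of_ne _ _ _ _ (by simpa using h) _
  · simp [he]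

open Classical in
theorem single_mul_sum_single {e : Ed} (he : E.s e = x) (i : Option Ed)
    (F : Ed → (E.removeSource hx).Leavitt K) (a : (E.removeSource hx).Leavitt K) :
    Matrix.single i (some e) a *
      (∑ e' : Ed with E.s e' = x, Matrix.single (some e') (some e') (F e')) =
        Matrix.single i (some e) (a * F e) := by
  rw [Finset.mul_sum, Finset.sum_eq_single e]
  · simp
  · intro e' _ h
    exact Matrix.single_mul_single_of_ne _ _ _ _ (by simpa using h.symm) _
  · simp [he]

-- The index `none` stands for the summand `B`, and `some e` with `s(e) = x` for `e B ≅ r(e) B`.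
-- Thus such an `e` moves `none` to `some e`, `e*` moves it back, and `x` is the sum of the
-- projections to the summands `some e`, which is the summation relation at `x`. The remaining
-- indices carry only zero entries. The vertices need not add up to the identity matrix, so the lift
-- without identity is needed.
open Classical in
theorem isLeavittFamily_sourceMatrix : E.IsLeavittFamily (E.sourceMatrix K hx) := by
  have hf := (E.removeSource hx).isLeavittFamily_gen K
  have hr : ∀ e : Ed, E.r e ≠ x := hx
  constructor
  case vertex_mul_self =>
    intro y
    by_cases hy : y = x
    · simp only [sourceMatrix, hy, ne_eq, not_true_eq_false, dite_false]
      rw [Finset.mul_sum]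
      refine Finset.sum_congr rfl fun e he => ?_
      rw [E.sum_single_mul_single K hx (Finset.mem_filter.1 he).2, hf.vertex_mul_self]
    · simp [sourceMatrix, hy, hf.vertex_mul_self]
  case vertex_mul_of_ne =>
    intro y z h
    by_cases hy : y = x
    · have hz : z ≠ x := fun hz => h (hy.trans hz.symm)
      simp [sourceMatrix, hy, hz, Finset.sum_mul]
    · by_cases hz : z = x
      · simp [sourceMatrix, hy, hz, Finset.mul_sum]
      · simp [sourceMatrix, hy, hz, hf.vertex_mul_of_ne ⟨y, hy⟩ ⟨z, hz⟩ (by simpa using h)]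
  case source_mul_edge =>
    intro e
    by_cases he : E.s e = x
    · simp only [sourceMatrix, he, ne_eq, not_true_eq_false, dite_false]
      rw [E.sum_single_mul_single K hx he, hf.vertex_mul_self]
    · simp only [sourceMatrix, ne_eq, he, not_false_eq_true, dite_true,
        Matrix.single_mul_single_same]
      exact congrArg (Matrix.single none none) (hf.source_mul_edge ⟨e, he⟩)
  case edge_mul_range =>
    intro e
    by_cases he : E.s e = x
    · simp [sourceMatrix, he, hr, hf.vertex_mul_self]
    · simp only [sourceMatrix, ne_eq, he, hr, not_false_eq_true, dite_true,
        Matrix.single_mul_single_same]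
      exact congrArg (Matrix.single none none) (hf.edge_mul_range ⟨e, he⟩)
  case range_mul_ghost =>
    intro e
    by_cases he : E.s e = x
    · simp [sourceMatrix, he, hr, hf.vertex_mul_self]
    · simp only [sourceMatrix, ne_eq, he, hr, not_false_eq_true, dite_true,
        Matrix.single_mul_single_same]
      exact congrArg (Matrix.single none none) (hf.range_mul_ghost ⟨e, he⟩)
  case ghost_mul_source =>
    intro e
    by_cases he : E.s e = x
    · simp only [sourceMatrix, he, ne_eq, not_true_eq_false, dite_false]
      rw [E.single_mul_sum_single K hx he, hf.vertex_mul_self]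
    · simp only [sourceMatrix, ne_eq, he, not_false_eq_true, dite_true,
        Matrix.single_mul_single_same]
      exact congrArg (Matrix.single none none) (hf.ghost_mul_source ⟨e, he⟩)
  case ghost_mul_edge_self =>
    intro e
    by_cases he : E.s e = x
    · simp [sourceMatrix, he, hr, hf.vertex_mul_self]
    · simp only [sourceMatrix, ne_eq, he, hr, not_false_eq_true, dite_true,
        Matrix.single_mul_single_same]
      exact congrArg (Matrix.single none none) (hf.ghost_mul_edge_self ⟨e, he⟩)
  case ghost_mul_edge_of_ne =>
    intro e e' h
    by_cases he : E.s e = x <;> by_cases he' : E.s e' = x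
    · simp [sourceMatrix, he, he', h]
    · simp [sourceMatrix, he, he']
    · simp [sourceMatrix, he, he']
    · simp [sourceMatrix, he, he', hf.ghost_mul_edge_of_ne ⟨e, he⟩ ⟨e', he'⟩ (by simpa using h)]
  case sum_edge_mul_ghost =>
    intro y hy
    by_cases hyx : y = x
    · subst hyx
      simp only [sourceMatrix, ne_eq, not_true_eq_false, dite_false]
      refine Finset.sum_congr rfl fun e he => ?_
      simp [(Finset.mem_filter.1 he).2, hf.vertex_mul_self]
    · have hy' : ¬ (E.removeSource hx).IsSink ⟨y, hyx⟩ := by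
        intro h
        refine hy fun e he => h ⟨e, he ▸ hyx⟩ (Subtype.ext he)
      simp only [sourceMatrix, ne_eq, hyx, not_false_eq_true, dite_true]
      rw [← hf.sum_edge_mul_ghost ⟨y, hyx⟩ hy',
        ← Matrix.singleAddMonoidHom_apply (none : Option Ed) (none : Option Ed), map_sum]
      symm
      refine Finset.sum_bij (fun e _ => e.1) ?_ (fun _ _ _ _ h => Subtype.ext h) ?_ ?_
      · intro e he
        exact Finset.mem_filter.2 ⟨Finset.mem_univ _, congrArg Subtype.val (Finset.mem_filter.1 he).2⟩
      · intro e he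
        have he' : E.s e = y := by simpa using he
        exact ⟨⟨e, he' ▸ hyx⟩, by simpa using Subtype.ext he', rfl⟩
      · intro e he
        have := e.2
        simp [this]

-- Generators of the smaller graph act only in the entry `(none, none)`. Reading off this entry
-- inverts `removeSourceHom` from the left.
open Classical in
theorem lift_sourceMatrix_removeSourceHom (a : (E.removeSource hx).Leavitt K) :
    (E.isLeavittFamily_sourceMatrix K hx).lift K (E.removeSourceHom K hx a) =
      Matrix.single none none a := by
  induction a using (E.removeSource hx).leavitt_induction K with
  | one =>
    rw [E.removeSourceHom_one, sumNe, map_sum, ← (E.removeSource hx).sum_vertex K,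
      ← Matrix.singleAddMonoidHom_apply (none : Option Ed) (none : Option Ed), map_sum,
      Finset.sum_subtype (p := (· ≠ x)) _ (by simp)]
    refine Finset.sum_congr rfl fun y _ => ?_
    rw [IsLeavittFamily.lift_gen]
    simp [sourceMatrix, y.2]
  | gen_mul g a ha =>
    rw [map_mul, map_mul, ha, removeSourceHom_gen, IsLeavittFamily.lift_gen]
    have : E.sourceMatrix K hx (g.ofRemoveSource E) =
        Matrix.single none none ((E.removeSource hx).gen K g) := by
      cases g with
      | vertex y => simp [Gen.ofRemoveSource, sourceMatrix, y.2]
      | edge e => simp [Gen.ofRemoveSource, sourceMatrix, e.2]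
      | ghost e => simp [Gen.ofRemoveSource, sourceMatrix, e.2]
    rw [this, Matrix.single_mul_single_same]
  | add a b ha hb => rw [map_add, map_add, ha, hb, Matrix.single_add]
  | smul k a ha => rw [map_smul, map_smul, ha, Matrix.smul_single]

theorem removeSourceHom_injective : Function.Injective (E.removeSourceHom K hx) := by
  classical
  intro a b h
  have h' := congrArg ((E.isLeavittFamily_sourceMatrix K hx).lift K) h
  rw [lift_sourceMatrix_removeSourceHom, lift_sourceMatrix_removeSourceHom] at h'
  simpa using congrFun (congrFun h' none) none

/-! ### The homomorphism is graded -/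

theorem sumNe_mem_grading : E.sumNe K x ∈ E.grading K 0 :=
  Submodule.sum_mem _ fun y _ => E.gen_mem_grading K (.vertex y)

theorem removeSourceHom_mem_grading {i : ℤ} {b : (E.removeSource hx).Leavitt K}
    (hb : b ∈ (E.removeSource hx).grading K i) : E.removeSourceHom K hx b ∈ E.grading K i := by
  induction hb using Submodule.span_induction with
  | mem b hb =>
    obtain ⟨l, rfl, rfl⟩ := hb
    induction l with
    -- The empty word maps to `p`, not to `1`.
    | nil => simpa [removeSourceHom_one] using E.sumNe_mem_grading K
    | cons g l ih =>
      have h : (List.map ((E.removeSource hx).gen K) (g :: l)).prod =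
          (E.removeSource hx).gen K g * (l.map ((E.removeSource hx).gen K)).prod := by simp
      rw [h, map_mul, removeSourceHom_gen, List.map_cons, List.sum_cons,
        ← Gen.degree_ofRemoveSource E g]
      exact SetLike.mul_mem_graded (E.gen_mem_grading K _) ih
  | zero => rw [map_zero]; exact Submodule.zero_mem _
  | add b c _ _ hb hc => rw [map_add]; exact Submodule.add_mem _ hb hc
  | smul k b _ hb => rw [map_smul]; exact Submodule.smul_mem _ k hb

end DirectedGraph

/-- An injective graded homomorphism reflects degrees. -/
theorem mem_graded_iff_of_injective {K : Type*} [Field K] {A B Γ : Type*} [AddCommGroup Γ] [DecidableEq Γ]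
    [Ring A] [Algebra K A] [Ring B] [Algebra K B] (𝒜 : Γ → Submodule K A) [GradedAlgebra 𝒜]
    (ℬ : Γ → Submodule K B) [GradedAlgebra ℬ] (φ : B →ₙₐ[K] A) (hφ : Function.Injective φ)
    (hdeg : ∀ i, ∀ b ∈ ℬ i, φ b ∈ 𝒜 i) (i : Γ) (b : B) : b ∈ ℬ i ↔ φ b ∈ 𝒜 i := by
  refine ⟨hdeg i b, fun h => ?_⟩
  -- A degree-preserving map commutes with taking homogeneous components. If `φ b` is homogeneous of
  -- degree `i`, then `b` and its `i`-th component have the same image.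
  have key : ∀ (c : B) (j : Γ), φ (DirectSum.decompose ℬ c j) = DirectSum.decompose 𝒜 (φ c) j := by
    intro c j
    induction c using DirectSum.Decomposition.inductionOn ℬ with
    | zero => simp
    | @homogeneous k c =>
      by_cases hkj : k = j
      · subst hkj
        rw [DirectSum.decompose_of_mem_same _ c.2, DirectSum.decompose_of_mem_same _ (hdeg _ _ c.2)]
      · rw [DirectSum.decompose_of_mem_ne _ c.2 hkj,
          DirectSum.decompose_of_mem_ne _ (hdeg _ _ c.2) hkj, map_zero]
    | add c d hc hd => simp [DirectSum.decompose_add, hc, hd]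
  have : φ (DirectSum.decompose ℬ b i) = φ b := by
    rw [key, DirectSum.decompose_of_mem_same _ h]
  exact hφ this ▸ (DirectSum.decompose ℬ b i).2

/-! ## Full corners -/

open MulOpposite

/-- The homomorphism `φ`, which need not preserve the identity, is an isomorphism of `B` onto the
corner of `A` cut out by the idempotent `φ 1`, and this idempotent is full: the identity of `A` is
the sum of the products `left k * right k` of elements of `A * φ 1` and `φ 1 * A`. -/
structure FullCorner {K : Type w} [Field K] {A : Type u} [Ring A] [Algebra K A]
    {B : Type u} [Ring B] [Algebra K B] (φ : B →ₙₐ[K] A) (ι : Type m) [Fintype ι] where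
  injective : Function.Injective φ
  exists_eq : ∀ a, ∃ b, φ b = φ 1 * a * φ 1
  left : ι → A
  right : ι → A
  left_mul : ∀ k, left k * φ 1 = left k
  mul_right : ∀ k, φ 1 * right k = right k
  sum_eq_one : ∑ k, left k * right k = 1

section FullCorner

variable {K : Type w} [Field K] {A : Type u} [Ring A] [Algebra K A]
  {B : Type u} [Ring B] [Algebra K B] (φ : B →ₙₐ[K] A)

/-! ### The restriction of a module to a corner -/

/-- The subgroup `M p` of a right `A`-module `M`, where `p = φ 1`. -/
def cornerModule (M : Type m) [AddCommGroup M] [Module Aᵐᵒᵖ M] : AddSubgroup M where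
  carrier := {x | op (φ 1) • x = x}
  zero_mem' := smul_zero _
  add_mem' {x y} hx hy := by rw [Set.mem_ofPred_eq, smul_add, hx, hy]
  neg_mem' {x} hx := by rw [Set.mem_ofPred_eq, smul_neg, hx]

section

variable {M : Type m} [AddCommGroup M] [Module Aᵐᵒᵖ M]

theorem smul_mem_cornerModule (b : B) (x : M) : op (φ b) • x ∈ cornerModule φ M := by
  change op (φ 1) • op (φ b) • x = op (φ b) • x
  rw [smul_smul, ← op_mul, ← map_mul, mul_one]

instance cornerModule.instSMul : SMul Bᵐᵒᵖ (cornerModule φ M) where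
  smul b x := ⟨op (φ b.unop) • x.1, smul_mem_cornerModule φ b.unop x.1⟩

theorem cornerModule.coe_smul (b : Bᵐᵒᵖ) (x : cornerModule φ M) :
    (b • x).1 = op (φ b.unop) • x.1 := rfl

instance cornerModule.instModule : Module Bᵐᵒᵖ (cornerModule φ M) where
  -- The condition `x p = x` that defines the corner is the unit law over `B`.
  one_smul x := Subtype.ext x.2
  mul_smul b c x := Subtype.ext (by
    simp only [cornerModule.coe_smul, unop_mul, map_mul, op_mul, mul_smul])
  smul_zero b := Subtype.ext (smul_zero _)
  smul_add b x y := Subtype.ext (smul_add _ _ _)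
  add_smul b c x := Subtype.ext (by
    simp only [cornerModule.coe_smul, MulOpposite.unop_add, map_add, MulOpposite.op_add,
      add_smul, AddSubgroup.coe_add])
  zero_smul x := Subtype.ext (by
    simp only [cornerModule.coe_smul, unop_zero, map_zero, op_zero, zero_smul,
      AddSubgroup.coe_zero])

/-- The restriction of a homomorphism to corners. -/
def cornerModule.map {M' : Type*} [AddCommGroup M'] [Module Aᵐᵒᵖ M'] (f : M →ₗ[Aᵐᵒᵖ] M') :
    cornerModule φ M →ₗ[Bᵐᵒᵖ] cornerModule φ M' where
  toFun x := ⟨f x.1, by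
    change op (φ 1) • f x.1 = f x.1
    rw [← map_smul, show op (φ 1) • x.1 = x.1 from x.2]⟩
  map_add' x y := Subtype.ext (map_add f x.1 y.1)
  map_smul' b x := Subtype.ext (map_smul f (op (φ b.unop)) x.1)

/-- The projection of a module onto its corner. -/
def cornerModule.proj (M : Type m) [AddCommGroup M] [Module Aᵐᵒᵖ M] : M →+ cornerModule φ M where
  toFun x := ⟨op (φ 1) • x, smul_mem_cornerModule φ 1 x⟩
  map_zero' := Subtype.ext (smul_zero _)
  map_add' _ _ := Subtype.ext (smul_add _ _ _)

end

/-! ### Coinduction from a corner -/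

/-- The right `B`-homomorphisms from `A` (equivalently, from `A p` where `p = φ 1`) to `N`. -/
def coindModule (N : Type m) [AddCommGroup N] [Module Bᵐᵒᵖ N] : AddSubgroup (A →+ N) where
  carrier := {f | ∀ a b, f (a * φ b) = op b • f a}
  zero_mem' _ _ := (smul_zero _).symm
  add_mem' {f g} hf hg a b := by
    rw [AddMonoidHom.add_apply, AddMonoidHom.add_apply, hf, hg, smul_add]
  neg_mem' {f} hf a b := by
    rw [AddMonoidHom.neg_apply, AddMonoidHom.neg_apply, hf, smul_neg]

section

variable {N : Type m} [AddCommGroup N] [Module Bᵐᵒᵖ N]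

variable {φ} in
theorem coindModule.apply_mul (f : coindModule φ N) (a : A) (b : B) :
    f.1 (a * φ b) = op b • f.1 a := f.2 a b

variable {φ} in
theorem coindModule.apply_mul_one (f : coindModule φ N) (a : A) : f.1 (a * φ 1) = f.1 a := by
  rw [coindModule.apply_mul, op_one, one_smul]

variable {φ} in
theorem coindModule.ext {f g : coindModule φ N} (h : ∀ a, f.1 a = g.1 a) : f = g :=
  Subtype.ext (AddMonoidHom.ext h)

instance coindModule.instSMul : SMul Aᵐᵒᵖ (coindModule φ N) where
  smul a f := ⟨f.1.comp (AddMonoidHom.mulLeft a.unop), fun c b => by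
    simp only [AddMonoidHom.comp_apply, AddMonoidHom.coe_mulLeft, ← mul_assoc,
      coindModule.apply_mul]⟩

theorem coindModule.smul_apply (a : Aᵐᵒᵖ) (f : coindModule φ N) (c : A) :
    (a • f).1 c = f.1 (a.unop * c) := rfl

instance coindModule.instModule : Module Aᵐᵒᵖ (coindModule φ N) where
  one_smul f := coindModule.ext fun c => by rw [coindModule.smul_apply, unop_one, one_mul]
  mul_smul a b f := coindModule.ext fun c => by
    simp only [coindModule.smul_apply, unop_mul, mul_assoc]
  smul_zero a := rfl
  smul_add a f g := rfl
  add_smul a b f := coindModule.ext fun c => by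
    rw [coindModule.smul_apply, MulOpposite.unop_add, add_mul, map_add]
    rfl
  zero_smul f := coindModule.ext fun c => by
    rw [coindModule.smul_apply, unop_zero, zero_mul, map_zero]
    rfl

/-- Postcomposition with a homomorphism. -/
def coindModule.map {N' : Type*} [AddCommGroup N'] [Module Bᵐᵒᵖ N'] (g : N →ₗ[Bᵐᵒᵖ] N') :
    coindModule φ N →ₗ[Aᵐᵒᵖ] coindModule φ N' where
  toFun f := ⟨g.toAddMonoidHom.comp f.1, fun a b => by
    change g (f.1 (a * φ b)) = op b • g (f.1 a)
    rw [coindModule.apply_mul, map_smul]⟩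
  map_add' f f' := coindModule.ext fun c => map_add g _ _
  map_smul' a f := rfl

/-- Evaluation at an element. -/
def coindModule.eval (a : A) : coindModule φ N →+ N where
  toFun f := f.1 a
  map_zero' := rfl
  map_add' _ _ := rfl

end

namespace FullCorner

variable {φ} {ι : Type*} [Fintype ι] (h : FullCorner φ ι)

/-- The element of `B` that corresponds to `p * a * p`, where `p = φ 1`. -/
noncomputable def compress (a : A) : B := (h.exists_eq a).choose

theorem map_compress (a : A) : φ (h.compress a) = φ 1 * a * φ 1 := (h.exists_eq a).choose_spec

theorem compress_add (a b : A) : h.compress (a + b) = h.compress a + h.compress b :=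
  h.injective (by simp only [map_add, map_compress, mul_add, add_mul])

theorem compress_mul (a : A) (b : B) : h.compress (a * φ b) = h.compress a * b :=
  h.injective (by
    rw [map_mul, map_compress, map_compress, mul_assoc, mul_assoc, ← map_mul, mul_one,
      mul_assoc, mul_assoc, ← map_mul, one_mul])

theorem compress_one_mul (a : A) : h.compress (φ 1 * a) = h.compress a :=
  h.injective (by rw [map_compress, map_compress, ← mul_assoc, ← map_mul, mul_one])

theorem compress_one : h.compress 1 = 1 :=
  h.injective (by rw [map_compress, mul_one, ← map_mul, mul_one])

/-- An element of `N`, as a homomorphism from `A`. -/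
noncomputable def ofElement {N : Type m} [AddCommGroup N] [Module Bᵐᵒᵖ N] (n : N) :
    coindModule φ N :=
  ⟨AddMonoidHom.mk' (fun a => op (h.compress a) • n) fun a b => by
    rw [compress_add, MulOpposite.op_add, add_smul], fun a b => by
    simp only [AddMonoidHom.mk'_apply, compress_mul, op_mul, mul_smul]⟩

theorem ofElement_apply {N : Type m} [AddCommGroup N] [Module Bᵐᵒᵖ N] (n : N) (a : A) :
    (h.ofElement n).1 a = op (h.compress a) • n := rfl

theorem ofElement_add {N : Type m} [AddCommGroup N] [Module Bᵐᵒᵖ N] (n n' : N) :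
    h.ofElement (n + n') = h.ofElement n + h.ofElement n' :=
  coindModule.ext fun _ => smul_add _ _ _

theorem ofElement_mem {N : Type m} [AddCommGroup N] [Module Bᵐᵒᵖ N] (n : N) :
    h.ofElement n ∈ cornerModule φ (coindModule φ N) :=
  coindModule.ext fun c => by
    rw [coindModule.smul_apply, ofElement_apply, ofElement_apply, unop_op, compress_one_mul]

/-- Since `left k = left k * p` and `f` ignores a factor `p` on the right, `a` may be replaced by `p
a p`, which comes from `B`. -/
theorem apply_left_mul {N : Type m} [AddCommGroup N] [Module Bᵐᵒᵖ N] (f : coindModule φ N)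
    (k : ι) (a : A) : f.1 (h.left k * a) = op (h.compress a) • f.1 (h.left k) := by
  rw [← coindModule.apply_mul, map_compress, ← mul_assoc, ← mul_assoc, left_mul,
    coindModule.apply_mul_one]

/-- The dual basis expansion: evaluate `f` at `c = ∑ left k * right k * c`. -/
theorem sum_smul_ofElement {N : Type m} [AddCommGroup N] [Module Bᵐᵒᵖ N] (f : coindModule φ N) :
    ∑ k, op (h.right k) • h.ofElement (f.1 (h.left k)) = f := by
  refine coindModule.ext fun c => ?_
  have hsum : (∑ k, op (h.right k) • h.ofElement (f.1 (h.left k))).1 c =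
      ∑ k, f.1 (h.left k * (h.right k * c)) := by
    refine (map_sum (coindModule.eval φ c) _ _).trans (Finset.sum_congr rfl fun k _ => ?_)
    exact (h.apply_left_mul f k (h.right k * c)).symm
  rw [hsum, ← map_sum]
  simp only [← mul_assoc]
  rw [← Finset.sum_mul, h.sum_eq_one, one_mul]

/-- The restriction of a coinduced module is the module one started with. -/
noncomputable def counitEquiv (N : Type m) [AddCommGroup N] [Module Bᵐᵒᵖ N] :
    cornerModule φ (coindModule φ N) ≃ₗ[Bᵐᵒᵖ] N where
  toFun f := f.1.1 1
  map_add' _ _ := rfl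
  map_smul' b f := by
    change f.1.1 (φ b.unop * 1) = b • f.1.1 1
    rw [mul_one, ← one_mul (φ b.unop), coindModule.apply_mul, op_unop]
  invFun n := ⟨h.ofElement n, h.ofElement_mem n⟩
  left_inv f := Subtype.ext <| coindModule.ext fun c => by
    rw [ofElement_apply, ← coindModule.apply_mul, one_mul, map_compress,
      coindModule.apply_mul_one]
    -- Membership of `f` in the corner says `f (p c) = f c`.
    exact congrArg (fun g : coindModule φ N => g.1 c) f.2
  right_inv n := by
    change op (h.compress 1) • n = n
    rw [compress_one, op_one, one_smul]

/-- A module is coinduced from its restriction. -/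
noncomputable def unitEquiv (M : Type m) [AddCommGroup M] [Module Aᵐᵒᵖ M] :
    M ≃ₗ[Aᵐᵒᵖ] coindModule φ (cornerModule φ M) where
  toFun x := ⟨AddMonoidHom.mk' (fun a => cornerModule.proj φ M (op a • x)) fun a b => by
      rw [MulOpposite.op_add, add_smul, map_add], fun a b => Subtype.ext (by
        change op (φ 1) • op (a * φ b) • x = op (φ b) • op (φ 1) • op a • x
        simp only [smul_smul, ← op_mul, ← map_mul, mul_assoc, one_mul, mul_one])⟩
  map_add' x y := coindModule.ext fun a => by
    change cornerModule.proj φ M (op a • (x + y)) = _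
    rw [smul_add, map_add]
    rfl
  map_smul' b x := coindModule.ext fun a => by
    change cornerModule.proj φ M (op a • b • x) = cornerModule.proj φ M (op (b.unop * a) • x)
    rw [op_mul, op_unop, mul_smul]
  invFun f := ∑ k, op (h.right k) • (f.1 (h.left k)).1
  left_inv x := by
    change ∑ k, op (h.right k) • op (φ 1) • op (h.left k) • x = x
    simp only [smul_smul, ← op_mul, left_mul, ← Finset.sum_smul]
    rw [← Finset.op_sum, h.sum_eq_one, op_one, one_smul]
  right_inv f := by
    refine coindModule.ext fun c => Subtype.ext ?_
    conv_rhs => rw [← h.sum_smul_ofElement f]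
    have hsum : (∑ k, op (h.right k) • h.ofElement (f.1 (h.left k))).1 c =
        ∑ k, op (h.compress (h.right k * c)) • f.1 (h.left k) :=
      map_sum (coindModule.eval φ c) _ _
    rw [hsum, AddSubgroup.val_finsetSum]
    change op (φ 1) • op c • ∑ k, op (h.right k) • (f.1 (h.left k)).1 = _
    rw [Finset.smul_sum, Finset.smul_sum]
    refine Finset.sum_congr rfl fun k _ => ?_
    rw [cornerModule.coe_smul, unop_op, map_compress, ← mul_assoc, mul_right]
    simp only [op_mul, mul_smul]

theorem unitEquiv_symm_apply (M : Type m) [AddCommGroup M] [Module Aᵐᵒᵖ M]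
    (f : coindModule φ (cornerModule φ M)) :
    (h.unitEquiv M).symm f = ∑ k, op (h.right k) • (f.1 (h.left k)).1 := rfl

end FullCorner

/-! ### Morita equivalence -/

/-- The restriction of modules to a corner, as a functor. -/
def cornerFunctor : ModuleCat.{u} Aᵐᵒᵖ ⥤ ModuleCat.{u} Bᵐᵒᵖ where
  obj M := ModuleCat.of _ (cornerModule φ M)
  map f := ModuleCat.ofHom (cornerModule.map φ f.hom)

/-- The coinduction of modules from a corner, as a functor. -/
def coindFunctor : ModuleCat.{u} Bᵐᵒᵖ ⥤ ModuleCat.{u} Aᵐᵒᵖ where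
  obj N := ModuleCat.of _ (coindModule φ N)
  map f := ModuleCat.ofHom (coindModule.map φ f.hom)

/-- Scalars act through `k • 1` over `A` and through `φ (k • 1) = k • p` over `B`; the two agree on
`M p`. -/
theorem cornerFunctor_linear : (cornerFunctor φ).Linear K where
  map_smul {M N} f k := by
    refine ModuleCat.hom_ext (LinearMap.ext fun x => Subtype.ext ?_)
    change op (algebraMap K A k) • f.hom x.1 = op (φ (algebraMap K B k)) • f.hom x.1
    have hx : op (φ 1) • f.hom x.1 = f.hom x.1 := (cornerModule.map φ f.hom x).2
    conv_lhs => rw [← hx]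
    rw [Algebra.algebraMap_eq_smul_one k (A := B), map_smul, smul_smul, ← op_mul,
      ← Algebra.commutes, ← Algebra.smul_def]

variable {φ} in
/-- An algebra is Morita equivalent to its full corners. -/
theorem FullCorner.isMoritaEquivalent {ι : Type*} [Fintype ι] (h : FullCorner φ ι) :
    IsMoritaEquivalent K Bᵐᵒᵖ Aᵐᵒᵖ := by
  -- The equivalence is built from `A` to `B`, so that linearity is needed for restriction only.
  refine IsMoritaEquivalent.symm _
    ⟨⟨⟨CategoryTheory.Equivalence.mk (cornerFunctor φ) (coindFunctor φ)
    (NatIso.ofComponents (fun M => (h.unitEquiv M).toModuleIso) ?_)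
    (NatIso.ofComponents (fun N => (h.counitEquiv N).toModuleIso) ?_), cornerFunctor_linear φ⟩⟩⟩
  · intro M M' f
    refine ModuleCat.hom_ext (LinearMap.ext fun x => coindModule.ext fun a => Subtype.ext ?_)
    change op (φ 1) • op a • f.hom x = f.hom (op (φ 1) • op a • x)
    rw [map_smul, map_smul]
  · intro N N' f
    rfl

end FullCorner

/-! ## Graded modules over full corners -/

section GradedCorner

/-- A family of subgroups that generates `G` and is mapped to internal gradings by a jointly injective
family of homomorphisms is an internal grading. -/
theorem DirectSum.isInternal_of_jointly_injective {Γ : Type*} [DecidableEq Γ] {G : Type*}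
    [AddCommGroup G] (D : Γ → AddSubgroup G) (htop : ∀ g, g ∈ ⨆ i, D i)
    {κ H : Type*} [AddCommGroup H] (t : κ → G →+ H) (D' : κ → Γ → AddSubgroup H)
    (hD' : ∀ k, DirectSum.IsInternal (D' k)) (hmap : ∀ k i, ∀ g ∈ D i, t k g ∈ D' k i)
    (hinj : ∀ g, (∀ k, t k g = 0) → g = 0) : DirectSum.IsInternal D := by
  constructor
  · rw [injective_iff_map_eq_zero]
    intro x hx
    let T : ∀ k, (DirectSum Γ fun i => D i) →+ DirectSum Γ fun i => D' k i := fun k =>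
      -- Applying `t k` componentwise is compatible with summation, so a family with sum zero has
      -- all its components killed by every `t k`.
      DirectSum.map fun i => ((t k).comp (D i).subtype).codRestrict (D' k i)
        fun g => hmap k i g.1 g.2
    have hT : ∀ k, T k x = 0 := by
      intro k
      refine (injective_iff_map_eq_zero _).1 (hD' k).1 _ ?_
      have hcomp : (DirectSum.coeAddMonoidHom (D' k)).comp (T k) =
          (t k).comp (DirectSum.coeAddMonoidHom D) := by
        refine DirectSum.addHom_ext fun i g => ?_
        simp only [AddMonoidHom.comp_apply, T, DirectSum.map_of, DirectSum.coeAddMonoidHom_of]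
        rfl
      exact (DFunLike.congr_fun hcomp x).trans ((congrArg (t k) hx).trans (map_zero _))
    ext i
    refine hinj _ fun k => ?_
    have h := congrArg (fun y : DirectSum Γ fun i => D' k i => (y i).1) (hT k)
    rwa [DirectSum.map_apply] at h
  · intro g
    refine AddSubgroup.iSup_induction D (C := fun g => ∃ x, DirectSum.coeAddMonoidHom D x = g)
      (htop g) (fun i g hg => ⟨DirectSum.of (fun i => D i) i ⟨g, hg⟩, by simp⟩)
      ⟨0, map_zero _⟩ ?_
    rintro _ _ ⟨x, rfl⟩ ⟨y, rfl⟩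
    exact ⟨x + y, map_add _ _ _⟩

/-! ### Replacing the grading of a module by an equal one -/

section Congr

variable {Γ : Type v} [AddCommGroup Γ] [DecidableEq Γ] {A : Type u} [Ring A] {σ : Type w}
  [SetLike σ A] {𝒜 : Γ → σ} {C : Type m} [AddCommGroup C] [Module Aᵐᵒᵖ C]
  {D : Type m} [AddCommGroup D] [Module Aᵐᵒᵖ D]

theorem GrMod.mk_congr {deg deg' : Γ → AddSubgroup C} (h : deg = deg')
    (hi : DirectSum.IsInternal deg) (hi' : DirectSum.IsInternal deg')
    (hs : ∀ {i j : Γ} {x : C} {a : A}, x ∈ deg i → a ∈ 𝒜 j → op a • x ∈ deg (i + j))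
    (hs' : ∀ {i j : Γ} {x : C} {a : A}, x ∈ deg' i → a ∈ 𝒜 j → op a • x ∈ deg' (i + j)) :
    (⟨C, deg, hi, hs⟩ : GrMod.{u, v, w, m} 𝒜) = ⟨C, deg', hi', hs'⟩ := by
  subst h
  rfl

/-- Commuting with shifts is an equality of functors. The gradings to be compared are equal but not
definitionally so, hence morphisms are compared by `HEq`. -/
theorem GrMod.hom_heq {deg deg' : Γ → AddSubgroup C} (h : deg = deg')
    (hi : DirectSum.IsInternal deg) (hi' : DirectSum.IsInternal deg')
    (hs : ∀ {i j : Γ} {x : C} {a : A}, x ∈ deg i → a ∈ 𝒜 j → op a • x ∈ deg (i + j))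
    (hs' : ∀ {i j : Γ} {x : C} {a : A}, x ∈ deg' i → a ∈ 𝒜 j → op a • x ∈ deg' (i + j))
    {e e' : Γ → AddSubgroup D} (he : e = e')
    (hj : DirectSum.IsInternal e) (hj' : DirectSum.IsInternal e')
    (ht : ∀ {i j : Γ} {x : D} {a : A}, x ∈ e i → a ∈ 𝒜 j → op a • x ∈ e (i + j))
    (ht' : ∀ {i j : Γ} {x : D} {a : A}, x ∈ e' i → a ∈ 𝒜 j → op a • x ∈ e' (i + j))
    (f : C →ₗ[Aᵐᵒᵖ] D) (hf : ∀ i x, x ∈ deg i → f x ∈ e i)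
    (hf' : ∀ i x, x ∈ deg' i → f x ∈ e' i) :
    HEq (⟨f, hf⟩ : GrMod.Hom (⟨C, deg, hi, hs⟩ : GrMod.{u, v, w, m} 𝒜) ⟨D, e, hj, ht⟩)
      (⟨f, hf'⟩ : GrMod.Hom (⟨C, deg', hi', hs'⟩ : GrMod.{u, v, w, m} 𝒜) ⟨D, e', hj', ht'⟩) := by
  subst h he
  rfl

end Congr

/-- The homogeneous elements generate a graded module. -/
theorem GrMod.induction {Γ : Type*} [AddCommGroup Γ] [DecidableEq Γ] {A : Type*} [Ring A]
    {σ : Type*} [SetLike σ A] {𝒜 : Γ → σ} (M : GrMod 𝒜) {P : M.carrier → Prop}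
    (homogeneous : ∀ i, ∀ x ∈ M.deg i, P x) (zero : P 0) (add : ∀ x y, P x → P y → P (x + y))
    (x : M.carrier) : P x := by
  obtain ⟨x, rfl⟩ := M.isInternal.2 x
  induction x using DirectSum.induction_on with
  | zero => simpa using zero
  | of i x => simpa using homogeneous i _ x.2
  | add x y hx hy => simpa using add _ _ hx hy

variable {Γ : Type v} [AddCommGroup Γ] [DecidableEq Γ]
  {K : Type w} [Field K] {A : Type u} [Ring A] [Algebra K A] {B : Type u} [Ring B] [Algebra K B]

/-- The full corner `B` of `A` is compatible with the gradings: the isomorphism onto the corner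
preserves degrees, and `left k`, `right k` are homogeneous of opposite degrees. -/
structure FullCorner.IsGraded {φ : B →ₙₐ[K] A} {ι : Type*} [Fintype ι] (h : FullCorner φ ι)
    (𝒜 : Γ → Submodule K A) (ℬ : Γ → Submodule K B) (d : ι → Γ) : Prop where
  mem_iff : ∀ i b, b ∈ ℬ i ↔ φ b ∈ 𝒜 i
  left_mem : ∀ k, h.left k ∈ 𝒜 (d k)
  right_mem : ∀ k, h.right k ∈ 𝒜 (-d k)

namespace FullCorner.IsGraded

variable {φ : B →ₙₐ[K] A} {ι : Type*} [Fintype ι] {h : FullCorner φ ι}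
    {𝒜 : Γ → Submodule K A} [GradedAlgebra 𝒜] {ℬ : Γ → Submodule K B} [GradedAlgebra ℬ]
    {d : ι → Γ} (hd : h.IsGraded 𝒜 ℬ d)

include hd

omit [GradedAlgebra 𝒜] in
theorem map_one_mem : φ 1 ∈ 𝒜 0 := (hd.mem_iff 0 1).1 SetLike.GradedOne.one_mem

theorem compress_mem {i : Γ} {a : A} (ha : a ∈ 𝒜 i) : h.compress a ∈ ℬ i := by
  rw [hd.mem_iff, h.map_compress]
  have := SetLike.mul_mem_graded (SetLike.mul_mem_graded hd.map_one_mem ha) hd.map_one_mem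
  rwa [zero_add, add_zero] at this

/-- The restriction of a graded module to a corner. -/
def cornerGrMod (M : GrMod.{u, v, u, m} 𝒜) : GrMod.{u, v, u, m} ℬ where
  carrier := cornerModule φ M.carrier
  deg i := (M.deg i).comap (cornerModule φ M.carrier).subtype
  isInternal := by
    refine DirectSum.isInternal_of_jointly_injective (κ := Unit) _ ?_
      (fun _ => (cornerModule φ M.carrier).subtype) (fun _ => M.deg) (fun _ => M.isInternal)
      (fun _ _ _ hg => hg) (fun g hg => Subtype.ext (hg ()))
    intro g
    -- An element of the corner is its own projection, and projecting preserves degrees because `p`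
    -- has degree `0`. So its homogeneous components can be taken in the corner.
    have hg : cornerModule.proj φ M.carrier g.1 = g := Subtype.ext g.2
    rw [← hg]
    refine M.induction (P := fun x => cornerModule.proj φ M.carrier x ∈ _) ?_ ?_ ?_ g.1
    · intro i x hx
      refine AddSubgroup.mem_iSup_of_mem i ?_
      have := M.smul_mem hx hd.map_one_mem
      rwa [add_zero] at this
    · rw [map_zero]
      exact zero_mem _
    · intro x y hx hy
      rw [map_add]
      exact add_mem hx hy
  smul_mem hx hb := M.smul_mem hx ((hd.mem_iff _ _).1 hb)

/-- The restriction of graded modules to a corner, as a functor. -/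
def cornerGrFunctor : GrMod.{u, v, u, m} 𝒜 ⥤ GrMod.{u, v, u, m} ℬ where
  obj M := hd.cornerGrMod M
  map f := ⟨cornerModule.map φ f.toLin, fun i x hx => f.map_deg i x.1 hx⟩

omit [GradedAlgebra 𝒜] [GradedAlgebra ℬ] hd in
variable (φ 𝒜) in
/-- The homomorphisms of degree `i` from `A` to a graded module. -/
def coindDeg (N : GrMod.{u, v, u, m} ℬ) (i : Γ) : AddSubgroup (coindModule φ N.carrier) where
  carrier := {f | ∀ j, ∀ a ∈ 𝒜 j, f.1 a ∈ N.deg (i + j)}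
  zero_mem' _ _ _ := zero_mem _
  add_mem' hf hg j a ha := add_mem (hf j a ha) (hg j a ha)
  neg_mem' hf j a ha := neg_mem (hf j a ha)

omit [GradedAlgebra ℬ] hd in
theorem smul_mem_coindDeg (N : GrMod.{u, v, u, m} ℬ) {i j : Γ} {f : coindModule φ N.carrier}
    {a : A} (hf : f ∈ coindDeg φ 𝒜 N i) (ha : a ∈ 𝒜 j) : op a • f ∈ coindDeg φ 𝒜 N (i + j) := by
  intro k c hc
  rw [add_assoc]
  exact hf _ _ (SetLike.mul_mem_graded ha hc)

theorem ofElement_mem_coindDeg (N : GrMod.{u, v, u, m} ℬ) {i : Γ} {n : N.carrier}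
    (hn : n ∈ N.deg i) : h.ofElement n ∈ coindDeg φ 𝒜 N i :=
  fun _ _ ha => N.smul_mem hn (hd.compress_mem ha)

/-- The graded module coinduced from a corner. -/
def coindGrMod (N : GrMod.{u, v, u, m} ℬ) : GrMod.{u, v, u, max u m} 𝒜 where
  carrier := coindModule φ N.carrier
  deg := coindDeg φ 𝒜 N
  isInternal := by
    -- The jointly injective maps are the evaluations at homogeneous elements. Evaluation in degree
    -- `j` shifts the grading of `N` by `j`.
    refine DirectSum.isInternal_of_jointly_injective (κ := Σ j, 𝒜 j) _ ?_
      (fun k => coindModule.eval φ k.2.1) (fun k i => N.deg (i + k.1))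
      (fun k => N.isInternal_shift k.1) (fun k i f hf => hf k.1 k.2.1 k.2.2) ?_
    · intro f
      -- Finiteness of the dual basis makes every homomorphism a finite sum of homogeneous ones,
      -- after each value `f (left k)` is decomposed in `N`.
      rw [← h.sum_smul_ofElement f]
      refine sum_mem fun k _ => ?_
      refine N.induction (P := fun n => op (h.right k) • h.ofElement n ∈ _) ?_ ?_ ?_ (f.1 (h.left k))
      · intro i n hn
        exact AddSubgroup.mem_iSup_of_mem (i + -d k)
          (smul_mem_coindDeg N (hd.ofElement_mem_coindDeg N hn) (hd.right_mem k))
      · have h0 : h.ofElement (0 : N.carrier) = 0 := coindModule.ext fun _ => smul_zero _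
        rw [h0, smul_zero]
        exact zero_mem _
      · intro n n' hn hn'
        rw [h.ofElement_add, smul_add]
        exact add_mem hn hn'
    · intro f hf
      refine coindModule.ext fun a => ?_
      change f.1 a = 0
      induction a using DirectSum.Decomposition.inductionOn 𝒜 with
      | zero => exact map_zero _
      | @homogeneous i a => exact hf ⟨i, a⟩
      | add a b ha hb => rw [map_add, ha, hb, add_zero]
  smul_mem hf ha := smul_mem_coindDeg N hf ha

/-- The coinduction of graded modules from a corner, as a functor. -/
def coindGrFunctor : GrMod.{u, v, u, max u m} ℬ ⥤ GrMod.{u, v, u, max u m} 𝒜 where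
  obj N := hd.coindGrMod N
  map {N N'} f := ⟨coindModule.map φ f.toLin, fun i g hg j a ha => f.map_deg (i + j) _ (hg j a ha)⟩

omit [GradedAlgebra 𝒜] in
theorem cornerGrFunctor_isGradedFunctor :
    IsGradedFunctor (hd.cornerGrFunctor : GrMod.{u, v, u, m} 𝒜 ⥤ GrMod.{u, v, u, m} ℬ) :=
  fun _ => rfl

/-- The underlying module does not see the grading; the degrees `i + j + α` and `i + α + j` differ
only in the order of addition. -/
theorem coindGrFunctor_isGradedFunctor :
    IsGradedFunctor (hd.coindGrFunctor :
      GrMod.{u, v, u, max u m} ℬ ⥤ GrMod.{u, v, u, max u m} 𝒜) := by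
  intro α
  have hdeg : ∀ N : GrMod.{u, v, u, max u m} ℬ,
      coindDeg φ 𝒜 (N.shift α) = fun i => coindDeg φ 𝒜 N (i + α) := by
    intro N
    funext i
    ext f
    refine forall_congr' fun j => forall_congr' fun a => forall_congr' fun ha => ?_
    change f.1 a ∈ N.deg (i + j + α) ↔ f.1 a ∈ N.deg (i + α + j)
    rw [add_right_comm]
  exact CategoryTheory.Functor.hext
    (fun N => GrMod.mk_congr (hdeg N) _ _ (hd.coindGrMod (N.shift α)).smul_mem
      ((hd.coindGrMod N).shift α).smul_mem)
    fun N N' f => GrMod.hom_heq (hdeg N) _ _ (hd.coindGrMod (N.shift α)).smul_mem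
      ((hd.coindGrMod N).shift α).smul_mem (hdeg N') _ _ (hd.coindGrMod (N'.shift α)).smul_mem
      ((hd.coindGrMod N').shift α).smul_mem _ _ _

/-- A bijective graded homomorphism with graded inverse is an isomorphism. -/
def _root_.GrMod.isoOfLinearEquiv {A : Type u} [Ring A] {σ : Type w} [SetLike σ A] {𝒜 : Γ → σ}
    {M N : GrMod.{u, v, w, m} 𝒜} (e : M.carrier ≃ₗ[Aᵐᵒᵖ] N.carrier)
    (he : ∀ i, ∀ x ∈ M.deg i, e x ∈ N.deg i) (he' : ∀ i, ∀ y ∈ N.deg i, e.symm y ∈ M.deg i) :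
    M ≅ N where
  hom := ⟨e, he⟩
  inv := ⟨e.symm, he'⟩
  hom_inv_id := GrMod.Hom.ext (LinearMap.ext e.symm_apply_apply)
  inv_hom_id := GrMod.Hom.ext (LinearMap.ext e.apply_symm_apply)

omit [GradedAlgebra 𝒜] in
theorem unitEquiv_mem (M : GrMod.{u, v, u, m} 𝒜) (i : Γ) (x : M.carrier) (hx : x ∈ M.deg i) :
    h.unitEquiv M.carrier x ∈ coindDeg φ 𝒜 (hd.cornerGrMod M) i := by
  intro j a ha
  have := M.smul_mem (M.smul_mem hx ha) hd.map_one_mem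
  rwa [add_zero] at this

-- The degrees of `left k` and `right k` cancel, so each term `f (left k) * right k` of the inverse
-- stays in degree `i`.
omit [GradedAlgebra 𝒜] in
theorem unitEquiv_symm_mem (M : GrMod.{u, v, u, m} 𝒜) (i : Γ)
    (f : coindModule φ (cornerModule φ M.carrier))
    (hf : f ∈ coindDeg φ 𝒜 (hd.cornerGrMod M) i) :
    (h.unitEquiv M.carrier).symm f ∈ M.deg i := by
  rw [h.unitEquiv_symm_apply]
  refine sum_mem fun k _ => ?_
  have := M.smul_mem (hf _ _ (hd.left_mem k)) (hd.right_mem k)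
  rwa [add_neg_cancel_right] at this

theorem isGradedEquivalence_coindGrFunctor :
    IsGradedEquivalence (hd.coindGrFunctor :
      GrMod.{u, v, u, max u m} ℬ ⥤ GrMod.{u, v, u, max u m} 𝒜) := by
  refine ⟨hd.coindGrFunctor_isGradedFunctor, hd.cornerGrFunctor,
    hd.cornerGrFunctor_isGradedFunctor, ⟨?_⟩, ⟨?_⟩⟩
  · refine NatIso.ofComponents (fun N => GrMod.isoOfLinearEquiv (h.counitEquiv N.carrier) ?_ ?_)
      fun _ => rfl
    · intro i f hf
      have := hf 0 1 SetLike.GradedOne.one_mem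
      rwa [add_zero] at this
    · intro i n hn
      exact hd.ofElement_mem_coindDeg N hn
  · refine (NatIso.ofComponents (fun M => GrMod.isoOfLinearEquiv
      (N := hd.coindGrMod (hd.cornerGrMod M)) (h.unitEquiv M.carrier)
      (hd.unitEquiv_mem M) (hd.unitEquiv_symm_mem M)) fun {M M'} f => ?_ :
      𝟭 (GrMod.{u, v, u, max u m} 𝒜) ≅ hd.cornerGrFunctor ⋙ hd.coindGrFunctor).symm
    refine GrMod.Hom.ext (LinearMap.ext fun x => coindModule.ext fun a => Subtype.ext ?_)
    change op (φ 1) • op a • f.toLin x = f.toLin (op (φ 1) • op a • x)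
    rw [map_smul, map_smul]

end FullCorner.IsGraded

/-- A graded algebra is graded Morita equivalent to its full corners. -/
theorem FullCorner.IsGraded.isGradedMoritaEquivalent {φ : B →ₙₐ[K] A} {ι : Type*} [Fintype ι]
    {h : FullCorner φ ι} {𝒜 : Γ → Submodule K A} [GradedAlgebra 𝒜] {ℬ : Γ → Submodule K B}
    [GradedAlgebra ℬ] {d : ι → Γ} (hd : h.IsGraded 𝒜 ℬ d) : IsGradedMoritaEquivalent ℬ 𝒜 :=
  ⟨hd.coindGrFunctor, hd.isGradedEquivalence_coindGrFunctor⟩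

end GradedCorner

/-! ### Source elimination as a full graded corner -/

namespace DirectedGraph

variable {V : Type v} {Ed : Type w} (E : DirectedGraph V Ed)
  (K : Type u) [Field K] [Fintype V] [DecidableEq V] [Fintype Ed]
  {x : V} (hx : E.IsSource x)

/-- Source elimination of a vertex that is not a sink passes to a full corner: the vertices other
than `x`, and `α α*` for the edges `α` emitted by `x`, add up to the identity. -/
noncomputable def fullCornerRemoveSource (hsink : ¬ E.IsSink x) :
    FullCorner (E.removeSourceHom K hx) ({y : V // y ≠ x} ⊕ {e : Ed // E.s e = x}) where
  injective := E.removeSourceHom_injective K hx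
  exists_eq a := by
    rw [removeSourceHom_one]
    exact (E.corner_subset_range K hx a).1
  left := Sum.elim (fun y => E.gen K (.vertex y.1)) fun e => E.gen K (.edge e.1)
  right := Sum.elim (fun y => E.gen K (.vertex y.1)) fun e => E.gen K (.ghost e.1)
  left_mul := by
    rw [removeSourceHom_one]
    rintro (y | e)
    · exact E.vertex_mul_sumNe K y.2
    · exact E.edge_mul_sumNe K hx e.1
  mul_right := by
    rw [removeSourceHom_one]
    rintro (y | e)
    · exact E.sumNe_mul_vertex K y.2
    · exact E.sumNe_mul_ghost K hx e.1
  sum_eq_one := by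
    have hf := E.isLeavittFamily_gen K
    -- Since `x` is not a sink, it can be replaced by `∑ e e*` in `1 = p + x`.
    rw [Fintype.sum_sum_type, ← E.sumNe_add_vertex K (x := x), sumNe,
      ← hf.sum_edge_mul_ghost x hsink]
    congr 1
    · rw [Finset.sum_subtype (p := (· ≠ x)) _ (by simp)]
      exact Finset.sum_congr rfl fun y _ => hf.vertex_mul_self y.1
    · rw [Finset.sum_subtype (p := fun e => E.s e = x) _ (by simp)]
      rfl

theorem isGraded_fullCornerRemoveSource (hsink : ¬ E.IsSink x) :
    (E.fullCornerRemoveSource K hx hsink).IsGraded (E.grading K) ((E.removeSource hx).grading K)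
      (Sum.elim (fun _ => 0) fun _ => 1) where
  mem_iff := mem_graded_iff_of_injective _ _ _ (E.removeSourceHom_injective K hx)
    fun _ _ hb => E.removeSourceHom_mem_grading K hx hb
  left_mem := by
    rintro (y | e)
    · exact E.gen_mem_grading K (.vertex y.1)
    · exact E.gen_mem_grading K (.edge e.1)
  right_mem := by
    rintro (y | e)
    · exact E.gen_mem_grading K (.vertex y.1)
    · exact E.gen_mem_grading K (.ghost e.1)

end DirectedGraph

/-- The idempotent of a full corner generates the unit ideal. -/
theorem FullCorner.span_eq_top {K : Type w} [Field K] {A : Type u} [Ring A] [Algebra K A]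
    {B : Type u} [Ring B] [Algebra K B] {φ : B →ₙₐ[K] A} {ι : Type*} [Fintype ι]
    (h : FullCorner φ ι) : TwoSidedIdeal.span {φ 1} = ⊤ := by
  rw [← TwoSidedIdeal.one_mem_iff, ← h.sum_eq_one]
  refine sum_mem fun k _ => ?_
  -- Writing `left k` as `left k * φ 1` exhibits the idempotent inside each summand of `1`.
  rw [← h.left_mul]
  exact TwoSidedIdeal.mul_mem_right _ _ _ (TwoSidedIdeal.mul_mem_left _ _ _
    (TwoSidedIdeal.subset_span rfl))

theorem proposition7p1 (K : Type u) [Field K] {V : Type v} {Ed : Type w}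
    [Fintype V] [DecidableEq V] [Fintype Ed] (E : DirectedGraph V Ed)
    (hcard : 2 ≤ Fintype.card V) (hsink : ∀ x : V, ¬ E.IsSink x)
    (x : V) (hx : E.IsSource x) :
    -- the sum `p` of the vertices other than `x` is a full homogeneous idempotent
    IsFullHomogeneousIdempotent (E.grading K) (∑ y : V with y ≠ x, E.gen K (.vertex y)) ∧
    -- the inclusion of graphs induces a graded isomorphism of `L(E∖x)` onto `p L(E) p`
    (∃ φ : (E.removeSource hx).Leavitt K →ₙₐ[K] E.Leavitt K,
      (∀ y, φ ((E.removeSource hx).gen K (.vertex y)) = E.gen K (.vertex y.1)) ∧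
      (∀ e, φ ((E.removeSource hx).gen K (.edge e)) = E.gen K (.edge e.1)) ∧
      (∀ e, φ ((E.removeSource hx).gen K (.ghost e)) = E.gen K (.ghost e.1)) ∧
      IsGradedIsoOntoCorner (E.grading K) ((E.removeSource hx).grading K)
        (∑ y : V with y ≠ x, E.gen K (.vertex y)) φ) ∧
    -- graded Morita equivalence
    IsGradedMoritaEquivalent ((E.removeSource hx).grading K) (E.grading K) ∧
    -- Morita equivalence (categories of right modules)
    IsMoritaEquivalent K ((E.removeSource hx).Leavitt K)ᵐᵒᵖ (E.Leavitt K)ᵐᵒᵖ := by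
  have hd := E.isGraded_fullCornerRemoveSource K hx (hsink x)
  refine ⟨⟨E.isIdempotentElem_sumNe K, E.sumNe_mem_grading K, ?_⟩,
    ⟨E.removeSourceHom K hx, fun y => E.removeSourceHom_gen K hx _,
      fun e => E.removeSourceHom_gen K hx _, fun e => E.removeSourceHom_gen K hx _,
      E.removeSourceHom_injective K hx, E.range_removeSourceHom K hx, hd.mem_iff⟩,
    hd.isGradedMoritaEquivalent, (E.fullCornerRemoveSource K hx (hsink x)).isMoritaEquivalent⟩
  have h := (E.fullCornerRemoveSource K hx (hsink x)).span_eq_top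
  rwa [E.removeSourceHom_one K hx] at h
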